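/- Let $k$ and $N$ be positive integers with $k$ odd and $4\mid N$, and let $\chi$ be a Dirichlet character modulo $N$. Let $G$ be the group of pairs $(\alpha,\phi)$, where $\alpha=\begin{pmatrix}a&b\\c&d\end{pmatrix}\in \mathrm{GL}_2^+(\mathbb{Q})$ and $\phi$ is a holomorphic function on the upper half-plane with $\phi(z)^2=t\,(cz+d)/\sqrt{\det\alpha}$ for some $t\in\{\pm1\}$, with group law $(\alpha,\phi(z))(\beta,\psi(z))=(\alpha\beta,\phi(\beta z)\psi(z))$. It acts on functions on the upper half-plane by $f|[(\alpha,\phi)]_{k/2}(z)=f(\alpha z)\phi(z)^{-k}$. For $\gamma=\begin{pmatrix}a&b\\c&d\end{pmatrix}\in\Gamma_0(4)$ put $\tilde\gamma=(\gamma,j(\gamma,z))$ with $j(\gamma,z)=\left(\frac{c}{d}\right)\epsilon_d^{-1}\sqrt{cz+d}$ (Shimura's extended quadratic symbol, principal square root, $\epsilon_d=1$ or $i$ according as $d\equiv 1$ or $3 \bmod 4$), and let $\Delta_0(N)=\{\tilde\gamma:\gamma\in\Gamma_0(N)\}$, a subgroup of $G$. Let $M_{k/2}(N,\chi)$ be the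 space of holomorphic functions $f$ on the upper half-plane that are holomorphic at all cusps and satisfy $f|[\tilde\gamma]_{k/2}=\chi(d)f$ for all $\gamma=\begin{pmatrix}a&b\\c&d\end{pmatrix}\in\Gamma_0(N)$. For $n\ge1$ the Hecke operator $T_{n^2}$ on $M_{k/2}(N,\chi)$ is $$T_{n^2}f=n^{\frac k2-2}\sum_\nu\chi(a_\nu)\,f|[\xi_\nu]_{k/2},$$ where $\xi_\nu$ runs over representatives of the right cosets of $\Delta_0(N)$ in $\Delta_0(N)\,\xi\,\Delta_0(N)$, $\xi=\left(\begin{pmatrix}1&0\\0&n^2\end{pmatrix},n^{1/2}\right)$, and $a_\nu$ is the upper left entry of the matrix of $\xi_\nu$. Let $p\nmid N$ be a prime and let $\ell$ be a positive integer. For $1\le r\le\lfloor \ell/2\rfloor$ define integers $A_{r,\ell}(m)$ and $B_{r,\ell}(m)$ (for $r\le m\le \ell-r$) recursively by $A_{1,\ell}(m)=1$, $B_{1,\ell}(m)=\binom{\ell}{m}-1$ and, for $r\ge2$, $$A_{r,\ell}(m)=A_{r-1,\ell}(m)-\binom{\ell-2(r-1)}{m-(r-1)}A_{r-1,\ell}(r-1),\qquad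 B_{r,\ell}(m)=B_{r-1,\ell}(m)-\binom{\ell-2(r-1)}{m-(r-1)}B_{r-1,\ell}(r-1).$$ Put $\alpha_{r,\ell}=A_{r,\ell}(r)$ and $\beta_{r,\ell}=B_{r,\ell}(r)$. Then, as operators on $M_{k/2}(N,\chi)$, $$T_{p^{2\ell}}=(T_{p^2})^\ell-\sum_{r=1}^{\lfloor \ell/2\rfloor}\chi(p^{2r})\left(\alpha_{r,\ell}\,p^{r(k-2)-1}+\beta_{r,\ell}\,p^{r(k-2)}\right)(T_{p^2})^{\ell-2r}.$$ -/

import Mathlib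

open scoped MatrixGroups Manifold NumberTheorySymbols Pointwise
open UpperHalfPlane Matrix

noncomputable section

namespace HalfIntegral

/-! ### The group `G` of pairs `(α, φ)` -/

/-- A rational `2 × 2` matrix viewed as a real one, so that it acts on `ℍ`. -/
abbrev toReal : GL (Fin 2) ℚ →* GL (Fin 2) ℝ := GeneralLinearGroup.map (Rat.castHom ℝ)

/-- The group `G`: pairs `(α, φ)` with `α ∈ GL₂⁺(ℚ)` and `φ` holomorphic on `ℍ` such that
`φ(z)² = t (cz + d) / √(det α)` for some sign `t ∈ {1, -1}`. -/
@[ext]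
structure G where
  mat : GL (Fin 2) ℚ
  det_pos : 0 < mat.det.val
  phi : ℍ → ℂ
  holo : MDiff phi
  sq : ∃ t : ℂ, (t = 1 ∨ t = -1) ∧
    ∀ z : ℍ, phi z ^ 2 = t * (denom (toReal mat) z / (√((mat.det.val : ℚ) : ℝ) : ℂ))

namespace G

lemma toReal_det (g : GL (Fin 2) ℚ) : (toReal g).det.val = ((g.det.val : ℚ) : ℝ) := by
  simp [toReal, Matrix.det_fin_two]

lemma det_pos_real (x : G) : 0 < (toReal x.mat).det.val := by
  rw [toReal_det]; exact_mod_cast x.det_pos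

lemma sqrt_ne (x : G) : (√((x.mat.det.val : ℚ) : ℝ) : ℂ) ≠ 0 := by
  have : (0 : ℝ) < ((x.mat.det.val : ℚ) : ℝ) := by exact_mod_cast x.det_pos
  exact_mod_cast (Real.sqrt_pos.2 this).ne'

lemma phi_ne (x : G) (z : ℍ) : x.phi z ≠ 0 := by
  obtain ⟨t, ht, h⟩ := x.sq
  intro h0
  have h1 := h z
  rw [h0] at h1
  have ht' : t ≠ 0 := by rcases ht with rfl | rfl <;> norm_num
  exact mul_ne_zero ht' (div_ne_zero (denom_ne_zero _ z) x.sqrt_ne) (by rw [← h1]; norm_num)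

lemma denom_mul (g h : GL (Fin 2) ℝ) (hh : 0 < h.det.val) (z : ℍ) :
    denom (g * h) z = denom g ((h • z : ℍ) : ℂ) * denom h z := by
  rw [denom_cocycle g h z.im_ne_zero, coe_smul_of_det_pos hh]

/-- The group law `(α, φ) (β, ψ) = (αβ, φ(βz) ψ(z))`. -/
instance : Mul G where
  mul x y :=
    { mat := x.mat * y.mat
      det_pos := by
        rw [map_mul, Units.val_mul]
        exact mul_pos x.det_pos y.det_pos
      phi := fun z => x.phi (toReal y.mat • z) * y.phi z
      holo := (x.holo.comp (mdifferentiable_smul y.det_pos_real)).mul y.holo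
      sq := by
        obtain ⟨t, ht, h⟩ := x.sq
        obtain ⟨s, hs, h'⟩ := y.sq
        refine ⟨t * s, ?_, fun z => ?_⟩
        · rcases ht with rfl | rfl <;> rcases hs with rfl | rfl <;> norm_num
        · have hx : (0 : ℝ) ≤ ((x.mat.det.val : ℚ) : ℝ) := by exact_mod_cast x.det_pos.le
          rw [mul_pow, h, h', map_mul toReal, denom_mul _ _ y.det_pos_real, map_mul, Units.val_mul,
            Rat.cast_mul, Real.sqrt_mul hx]
          have := x.sqrt_ne
          have := y.sqrt_ne
          push_cast
          field_simp }

instance : One G where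
  one :=
    { mat := 1
      det_pos := by simp
      phi := fun _ => 1
      holo := mdifferentiable_const
      sq := ⟨1, Or.inl rfl, fun z => by simp⟩ }

instance : Inv G where
  inv x :=
    { mat := x.mat⁻¹
      det_pos := by
        rw [map_inv, Units.val_inv_eq_inv_val]
        exact inv_pos.2 x.det_pos
      phi := fun z => (x.phi (toReal x.mat⁻¹ • z))⁻¹
      holo := by
        have hd : 0 < (toReal x.mat⁻¹).det.val := by
          rw [map_inv, map_inv, Units.val_inv_eq_inv_val]
          exact inv_pos.2 x.det_pos_real
        have h1 := x.holo.comp (mdifferentiable_smul hd)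
        intro z
        have h2 : DifferentiableAt ℂ (fun w : ℂ => w⁻¹) (x.phi (toReal x.mat⁻¹ • z)) :=
          differentiableAt_inv (x.phi_ne _)
        exact h2.mdifferentiableAt.comp z (h1 z)
      sq := by
        obtain ⟨t, ht, h⟩ := x.sq
        refine ⟨t, ht, fun z => ?_⟩
        have hd : 0 < (toReal x.mat⁻¹).det.val := by
          rw [map_inv, map_inv, Units.val_inv_eq_inv_val]
          exact inv_pos.2 x.det_pos_real
        have hc := denom_mul (toReal x.mat) (toReal x.mat⁻¹) hd z
        rw [← map_mul, mul_inv_cancel, map_one, denom_one] at hc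
        have h1 := x.sqrt_ne
        have h2 : denom (toReal x.mat⁻¹) (z : ℂ) ≠ 0 := denom_ne_zero _ z
        have h3 : denom (toReal x.mat) ((toReal x.mat⁻¹ • z : ℍ) : ℂ) =
            (denom (toReal x.mat⁻¹) (z : ℂ))⁻¹ := eq_inv_of_mul_eq_one_left hc.symm
        have ht' : t⁻¹ = t := by rcases ht with rfl | rfl <;> norm_num
        have h4 : (x.mat⁻¹).det.val = (x.mat.det.val)⁻¹ := by
          rw [map_inv, Units.val_inv_eq_inv_val]
        rw [inv_pow, h, h3, h4, Rat.cast_inv, Real.sqrt_inv, mul_inv, ht', Complex.ofReal_inv]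
        field_simp }

lemma mul_mat (x y : G) : (x * y).mat = x.mat * y.mat := rfl
lemma mul_phi (x y : G) (z : ℍ) : (x * y).phi z = x.phi (toReal y.mat • z) * y.phi z := rfl
lemma one_mat : (1 : G).mat = 1 := rfl
lemma one_phi (z : ℍ) : (1 : G).phi z = 1 := rfl
lemma inv_mat (x : G) : (x⁻¹).mat = x.mat⁻¹ := rfl
lemma inv_phi (x : G) (z : ℍ) : (x⁻¹).phi z = (x.phi (toReal x.mat⁻¹ • z))⁻¹ := rfl

instance : Group G where
  mul_assoc x y z := by
    refine G.ext (mul_assoc _ _ _) (funext fun w => ?_)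
    simp only [mul_phi, mul_mat, map_mul, mul_smul, mul_assoc]
  one_mul x := by
    refine G.ext (one_mul _) (funext fun w => ?_)
    simp only [mul_phi, one_phi, one_mul]
  mul_one x := by
    refine G.ext (mul_one _) (funext fun w => ?_)
    simp only [mul_phi, one_phi, one_mat, map_one, one_smul, mul_one]
  inv_mul_cancel x := by
    refine G.ext (inv_mul_cancel _) (funext fun w => ?_)
    simp only [mul_phi, inv_phi, one_phi]
    rw [← mul_smul, ← map_mul, inv_mul_cancel, map_one, one_smul]
    exact inv_mul_cancel₀ (x.phi_ne w)

end G

/-- The slash operator `f|[ξ]_{k/2}(z) = f(αz) φ(z)^{-k}` for `ξ = (α, φ)`, linear in `f`. -/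
def slash (k : ℕ) (x : G) : (ℍ → ℂ) →ₗ[ℂ] (ℍ → ℂ) where
  toFun f := fun z => f (toReal x.mat • z) * (x.phi z ^ k)⁻¹
  map_add' f g := by
    funext z
    simp only [Pi.add_apply, add_mul]
  map_smul' c f := by
    funext z
    simp only [Pi.smul_apply, smul_eq_mul, RingHom.id_apply, mul_assoc]

lemma slash_apply (k : ℕ) (x : G) (f : ℍ → ℂ) (z : ℍ) :
    slash k x f z = f (toReal x.mat • z) * (x.phi z ^ k)⁻¹ := rfl

lemma slash_one (k : ℕ) (f : ℍ → ℂ) : slash k 1 f = f := by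
  funext z
  simp only [slash_apply, G.one_phi, G.one_mat, map_one, one_smul, one_pow, inv_one, mul_one]

lemma slash_mul (k : ℕ) (x y : G) (f : ℍ → ℂ) : slash k (x * y) f = slash k y (slash k x f) := by
  funext z
  simp only [slash_apply, G.mul_phi, G.mul_mat, map_mul, mul_smul, mul_pow, mul_inv, mul_assoc]

/-! ### The lift of `Γ₀(4)` to `G` -/

/-- Shimura's extension of the quadratic residue symbol `(c/d)` to odd, possibly negative, `d`:
it is the Jacobi symbol `(c/|d|)`, times `-1` when `c` and `d` are both negative.
In particular `(0/±1) = 1`. -/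
def kro (c d : ℤ) : ℤ :=
  if c < 0 ∧ d < 0 then -jacobiSym c d.natAbs else jacobiSym c d.natAbs

/-- `ε_d = 1` if `d ≡ 1 mod 4` and `ε_d = i` if `d ≡ 3 mod 4`. -/
def eps (d : ℤ) : ℂ := if d % 4 = 1 then 1 else Complex.I

/-- `j(γ, z) = (c/d) ε_d⁻¹ √(cz + d)`, with the principal branch of the square root. -/
def theta_j (γ : SL(2, ℤ)) (z : ℍ) : ℂ :=
  (kro (γ 1 0) (γ 1 1) : ℂ) * (eps (γ 1 1))⁻¹ * ((γ 1 0 : ℂ) * z + (γ 1 1 : ℂ)) ^ (1 / 2 : ℂ)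

lemma kro_sq (γ : SL(2, ℤ)) : (kro (γ 1 0) (γ 1 1) : ℂ) ^ 2 = 1 := by
  have hdet := γ.det_coe
  rw [Matrix.det_fin_two] at hdet
  have hc : IsCoprime (γ 1 0) (γ 1 1) := ⟨-γ 0 1, γ 0 0, by linarith⟩
  have hg : Int.gcd (γ 1 0) ((γ 1 1).natAbs : ℤ) = 1 := by
    rw [Int.gcd, Int.natAbs_natCast]
    exact Int.isCoprime_iff_gcd_eq_one.1 hc
  have hs : (jacobiSym (γ 1 0) (γ 1 1).natAbs) ^ 2 = 1 := jacobiSym.sq_one hg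
  have : (kro (γ 1 0) (γ 1 1)) ^ 2 = 1 := by
    unfold kro
    split_ifs
    · rw [neg_sq, hs]
    · exact hs
  exact_mod_cast this

lemma denom_SL (γ : SL(2, ℤ)) (z : ℂ) :
    denom (toReal (SpecialLinearGroup.mapGL ℚ γ)) z = (γ 1 0 : ℂ) * z + (γ 1 1 : ℂ) := by
  simp [denom, toReal]

lemma det_SL (γ : SL(2, ℤ)) : (SpecialLinearGroup.mapGL ℚ γ).det.val = 1 := by
  simp

lemma linear_ne (γ : SL(2, ℤ)) (z : ℍ) : (γ 1 0 : ℂ) * z + (γ 1 1 : ℂ) ≠ 0 := by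
  rw [← denom_SL]
  exact denom_ne_zero _ z

/-- The lift `γ ↦ γ̃ = (γ, j(γ, z))` of `Γ₀(4)` to `G`. -/
def tilde (γ : CongruenceSubgroup.Gamma0 4) : G where
  mat := SpecialLinearGroup.mapGL ℚ (γ : SL(2, ℤ))
  det_pos := by rw [det_SL]; exact one_pos
  phi := theta_j γ
  holo := by
    have hlin : MDiff (fun z : ℍ => (((γ : SL(2, ℤ)) 1 0 : ℤ) : ℂ) * (z : ℂ)
        + (((γ : SL(2, ℤ)) 1 1 : ℤ) : ℂ)) := by
      have := mdifferentiable_denom (toReal (SpecialLinearGroup.mapGL ℚ (γ : SL(2, ℤ))))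
      simpa only [denom_SL] using this
    by_cases hc : (γ : SL(2, ℤ)) 1 0 = 0
    · have : theta_j (γ : SL(2, ℤ)) = fun _ => (kro ((γ : SL(2, ℤ)) 1 0) ((γ : SL(2, ℤ)) 1 1) : ℂ) *
          (eps ((γ : SL(2, ℤ)) 1 1))⁻¹ * (((γ : SL(2, ℤ)) 1 1 : ℤ) : ℂ) ^ (1 / 2 : ℂ) := by
        funext z
        simp [theta_j, hc]
      rw [this]
      exact mdifferentiable_const
    · refine mdifferentiable_const.mul ?_
      intro z
      have hs : (((γ : SL(2, ℤ)) 1 0 : ℤ) : ℂ) * (z : ℂ) + (((γ : SL(2, ℤ)) 1 1 : ℤ) : ℂ)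
          ∈ Complex.slitPlane := by
        right
        have : (((γ : SL(2, ℤ)) 1 0 : ℤ) : ℝ) ≠ 0 := by exact_mod_cast hc
        simpa [z.im_ne_zero] using hc
      have h2 : DifferentiableAt ℂ (fun w : ℂ => w ^ (1 / 2 : ℂ))
          ((((γ : SL(2, ℤ)) 1 0 : ℤ) : ℂ) * (z : ℂ) + (((γ : SL(2, ℤ)) 1 1 : ℤ) : ℂ)) :=
        DifferentiableAt.cpow_const differentiableAt_id hs
      exact h2.mdifferentiableAt.comp z (hlin z)
  sq := by
    refine ⟨(eps ((γ : SL(2, ℤ)) 1 1))⁻¹ ^ 2, ?_, fun z => ?_⟩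
    · unfold eps
      split_ifs <;> simp
    · rw [det_SL, denom_SL, theta_j, mul_pow, mul_pow, kro_sq, one_mul, one_div,
        Complex.cpow_ofNat_inv_pow]
      simp

/-- The group `Δ₀(N)` (for `4 ∣ N`) attached to the elements `γ̃`, `γ ∈ Γ₀(N)`. These elements are
classically already closed under products and inverses, so the closure adds nothing. -/
def Delta0 (N : ℕ) : Subgroup G :=
  Subgroup.closure {x | ∃ γ : CongruenceSubgroup.Gamma0 4,
    (γ : SL(2, ℤ)) ∈ CongruenceSubgroup.Gamma0 N ∧ x = tilde γ}

/-! ### Modular forms of weight `k/2` -/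

/-- Functions holomorphic on `ℍ` and at every cusp: for every `ξ ∈ G` (so for every
`α ∈ GL₂⁺(ℚ)`), `f|[ξ]_{k/2}` is bounded as `Im z → ∞`. -/
def holoCusps (k : ℕ) : Submodule ℂ (ℍ → ℂ) where
  carrier := {f | MDiff f ∧ ∀ x : G, IsBoundedAtImInfty (slash k x f)}
  add_mem' := fun {f g} hf hg => ⟨hf.1.add hg.1, fun x => by
    rw [map_add]
    exact (hf.2 x).add (hg.2 x)⟩
  zero_mem' := ⟨mdifferentiable_const, fun x => by
    rw [map_zero]
    exact zero_form_isBoundedAtImInfty⟩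
  smul_mem' := fun c f hf => ⟨hf.1.const_smul c, fun x => by
    rw [map_smul]
    exact (hf.2 x).smul c⟩

/-- The space `M_{k/2}(N, χ)` of modular forms of weight `k/2`, level `N` (with `4 ∣ N`) and
character `χ`: holomorphic on `ℍ` and at the cusps, with `f|[γ̃]_{k/2} = χ(d) f` for all
`γ = (a b; c d) ∈ Γ₀(N)`. -/
def M (k : ℕ) {N : ℕ} (χ : DirichletCharacter ℂ N) : Submodule ℂ (ℍ → ℂ) where
  carrier := {f | f ∈ holoCusps k ∧ ∀ γ : CongruenceSubgroup.Gamma0 4,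
    (γ : SL(2, ℤ)) ∈ CongruenceSubgroup.Gamma0 N →
      slash k (tilde γ) f = χ (((γ : SL(2, ℤ)) 1 1 : ℤ) : ZMod N) • f}
  add_mem' := fun {f g} hf hg => ⟨add_mem hf.1 hg.1, fun γ hγ => by
    rw [map_add, hf.2 γ hγ, hg.2 γ hγ, smul_add]⟩
  zero_mem' := ⟨zero_mem _, fun γ _ => by rw [map_zero, smul_zero]⟩
  smul_mem' := fun c f hf => ⟨Submodule.smul_mem _ c hf.1, fun γ hγ => by
    rw [map_smul, hf.2 γ hγ, smul_comm]⟩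

/-! ### Hecke operators -/

/-- The element `ξ = ((1 0; 0 n²), n^{1/2})` of `G`. -/
def xi (n : ℕ) (hn : 0 < n) : G where
  mat := GeneralLinearGroup.mkOfDetNeZero !![1, 0; 0, (n : ℚ) ^ 2] (by
    have : (n : ℚ) ≠ 0 := by exact_mod_cast hn.ne'
    simp [Matrix.det_fin_two, this])
  det_pos := by
    have : (0 : ℚ) < n := by exact_mod_cast hn
    have h : (GeneralLinearGroup.mkOfDetNeZero !![1, 0; 0, (n : ℚ) ^ 2] (by
        simp [Matrix.det_fin_two, this.ne'])).det.val = (n : ℚ) ^ 2 := by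
      simp only [GeneralLinearGroup.val_det_apply, GeneralLinearGroup.mkOfDetNeZero]
      simp [Matrix.det_fin_two]
    rw [h]
    exact pow_pos this 2
  phi := fun _ => (√(n : ℝ) : ℂ)
  holo := mdifferentiable_const
  sq := by
    refine ⟨1, Or.inl rfl, fun z => ?_⟩
    have h0 : (0 : ℝ) < n := by exact_mod_cast hn
    have h1 : (n : ℂ) ≠ 0 := by exact_mod_cast hn.ne'
    have h2 : ((√(n : ℝ) : ℝ) : ℂ) ^ 2 = n := by
      rw [← Complex.ofReal_pow, Real.sq_sqrt h0.le]
      simp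
    rw [h2]
    simp only [GeneralLinearGroup.val_det_apply, GeneralLinearGroup.mkOfDetNeZero]
    simp [Matrix.det_fin_two, denom, toReal]
    field_simp

lemma coset_eq {N : ℕ} {x y : G} :
    Quotient.mk (QuotientGroup.rightRel (Delta0 N)) x =
      Quotient.mk (QuotientGroup.rightRel (Delta0 N)) y ↔ y * x⁻¹ ∈ Delta0 N := by
  rw [Quotient.eq, QuotientGroup.rightRel_apply]

lemma coset_out {N : ℕ} (w : G) : ∃ e ∈ Delta0 N,
    (Quotient.mk (QuotientGroup.rightRel (Delta0 N)) w).out = e * w :=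
  ⟨_, coset_eq.1 (Quotient.out_eq (Quotient.mk (QuotientGroup.rightRel (Delta0 N)) w)).symm,
    by group⟩

/-- The right cosets `Δ₀(N) ξ_ν` contained in the double coset `Δ₀(N) ξ Δ₀(N)`. -/
def cosets (N n : ℕ) (hn : 0 < n) : Set (Quotient (QuotientGroup.rightRel (Delta0 N))) :=
  Quotient.mk _ '' DoubleCoset.doubleCoset (xi n hn) (Delta0 N) (Delta0 N)

/-- The summand `χ(a) f|[ξ]_{k/2}`, where `a` is the upper left entry (an integer for the elements
of the double cosets used below) of the matrix of `ξ`. -/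
def term (k : ℕ) {N : ℕ} (χ : DirichletCharacter ℂ N) (x : G) : (ℍ → ℂ) →ₗ[ℂ] (ℍ → ℂ) :=
  χ (((x.mat 0 0 : ℚ).num : ℤ) : ZMod N) • slash k x

/-! #### Finiteness of the set of cosets -/

lemma ker_finite : Finite {x : G // x.mat = 1} := by
  have key : ∀ x : G, x.mat = 1 → ∀ z, x.phi z ^ 2 = x.phi I ^ 2 ∧ x.phi z ^ 4 = 1 := by
    intro x hx z
    obtain ⟨t, ht, h⟩ := x.sq
    have h' : ∀ w : ℍ, x.phi w ^ 2 = t := by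
      intro w
      rw [h, hx]
      simp
    refine ⟨by rw [h', h'], ?_⟩
    rw [show (4 : ℕ) = 2 * 2 from rfl, pow_mul, h']
    rcases ht with rfl | rfl <;> norm_num
  have hfin : Finite {c : ℂ // c ^ 4 = 1} := by
    have : {c : ℂ | c ^ 4 = 1}.Finite := by
      refine (((Polynomial.nthRoots 4 (1 : ℂ)).toFinset).finite_toSet).subset ?_
      intro c hc
      simpa [Polynomial.mem_nthRoots] using hc
    exact this.to_subtype
  refine Finite.of_injective
    (fun x : {x : G // x.mat = 1} => (⟨x.1.phi I, (key x.1 x.2 I).2⟩ : {c : ℂ // c ^ 4 = 1})) ?_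
  rintro ⟨x, hx⟩ ⟨y, hy⟩ hxy
  have hI : x.phi I = y.phi I := congrArg Subtype.val hxy
  have const : ∀ w : G, w.mat = 1 → w.phi = fun _ => w.phi I := by
    intro w hw
    have hprod : (w.phi - fun _ => w.phi I) * (w.phi + fun _ => w.phi I) = 0 := by
      funext z
      have := (key w hw z).1
      simp only [Pi.mul_apply, Pi.sub_apply, Pi.add_apply, Pi.zero_apply]
      linear_combination this
    rcases (mul_eq_zero_iff (w.holo.sub mdifferentiable_const)
      (w.holo.add mdifferentiable_const)).1 hprod with h | h
    · exact sub_eq_zero.1 h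
    · exfalso
      have := congrFun h I
      simp only [Pi.add_apply, Pi.zero_apply] at this
      exact w.phi_ne I (by linear_combination this / 2)
  refine Subtype.ext (G.ext (hx.trans hy.symm) ?_)
  rw [const x hx, const y hy, hI]

/-- The projection of `G` to `GL₂(ℝ)`. -/
def proj : G →* GL (Fin 2) ℝ where
  toFun x := toReal x.mat
  map_one' := by rw [G.one_mat, map_one]
  map_mul' x y := by rw [G.mul_mat, map_mul]

lemma toReal_injective : Function.Injective toReal := by
  intro g h hgh
  ext i j
  have := congrArg (fun u : GL (Fin 2) ℝ => u.1 i j) hgh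
  simpa [toReal] using this

lemma toReal_mapGL (γ : SL(2, ℤ)) :
    toReal (SpecialLinearGroup.mapGL ℚ γ) = SpecialLinearGroup.mapGL ℝ γ := by
  ext i j
  simp [toReal]

/-- `Γ₀(4) ∩ Γ₀(N)`. -/
def Gam (N : ℕ) : Subgroup SL(2, ℤ) :=
  CongruenceSubgroup.Gamma0 4 ⊓ CongruenceSubgroup.Gamma0 N

lemma Delta0_mat {N : ℕ} {x : G} (hx : x ∈ Delta0 N) :
    ∃ γ ∈ Gam N, x.mat = SpecialLinearGroup.mapGL ℚ γ := by
  induction hx using Subgroup.closure_induction with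
  | mem x hx =>
    obtain ⟨γ, hγ, rfl⟩ := hx
    exact ⟨γ, ⟨γ.2, hγ⟩, rfl⟩
  | one => exact ⟨1, one_mem _, by rw [G.one_mat, map_one]⟩
  | mul x y _ _ hx hy =>
    obtain ⟨γ, hγ, h⟩ := hx
    obtain ⟨γ', hγ', h'⟩ := hy
    exact ⟨γ * γ', mul_mem hγ hγ', by rw [G.mul_mat, h, h', map_mul]⟩
  | inv x _ hx =>
    obtain ⟨γ, hγ, h⟩ := hx
    exact ⟨γ⁻¹, inv_mem hγ, by rw [G.inv_mat, h, map_inv]⟩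

/-- The preimage of `Γ₀(4) ∩ Γ₀(N)` in `G`. -/
def K (N : ℕ) : Subgroup G := ((Gam N).map (SpecialLinearGroup.mapGL ℝ)).comap proj

lemma mem_K {N : ℕ} {x : G} : x ∈ K N ↔ ∃ γ ∈ Gam N, x.mat = SpecialLinearGroup.mapGL ℚ γ := by
  constructor
  · rintro ⟨γ, hγ, h⟩
    refine ⟨γ, hγ, toReal_injective ?_⟩
    rw [toReal_mapGL, h]
    rfl
  · rintro ⟨γ, hγ, h⟩
    refine ⟨γ, hγ, ?_⟩
    rw [← toReal_mapGL, ← h]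
    rfl

lemma Delta0_le_K (N : ℕ) : Delta0 N ≤ K N := fun _ hx => mem_K.2 (Delta0_mat hx)

lemma commensurable_Delta0_K (N : ℕ) : Subgroup.Commensurable (Delta0 N) (K N) := by
  refine ⟨?_, by rw [Subgroup.relIndex_eq_one.2 (Delta0_le_K N)]; exact one_ne_zero⟩
  have hk := ker_finite
  have hmem : ∀ x : G, x.mat = 1 → x ∈ K N := fun x hx =>
    mem_K.2 ⟨1, one_mem _, by rw [hx, map_one]⟩
  have : Finite (K N ⧸ (Delta0 N).subgroupOf (K N)) := by
    refine Finite.of_surjective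
      (fun x : {x : G // x.mat = 1} =>
        ((⟨x.1, hmem x.1 x.2⟩ : K N) : K N ⧸ (Delta0 N).subgroupOf (K N))) ?_
    intro q
    induction q using QuotientGroup.induction_on with
    | H x =>
      obtain ⟨γ, hγ, h⟩ := mem_K.1 x.2
      have hd : tilde ⟨γ, hγ.1⟩ ∈ Delta0 N := Subgroup.subset_closure ⟨⟨γ, hγ.1⟩, hγ.2, rfl⟩
      refine ⟨⟨x.1 * (tilde ⟨γ, hγ.1⟩)⁻¹, ?_⟩, ?_⟩
      · rw [G.mul_mat, G.inv_mat, h]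
        exact mul_inv_cancel _
      · rw [QuotientGroup.eq, Subgroup.mem_subgroupOf]
        simpa using hd
  exact Subgroup.index_ne_zero_of_finite

lemma commensurable_conj_K (N : ℕ) [NeZero N] (x : G) :
    Subgroup.Commensurable (ConjAct.toConjAct x • K N) (K N) := by
  have hfi : (Gam N).FiniteIndex := by unfold Gam; infer_instance
  let 𝒢 : Subgroup (GL (Fin 2) ℝ) := (Gam N).map (SpecialLinearGroup.mapGL ℝ)
  have hG : 𝒢.IsArithmetic := Subgroup.isArithmetic_iff_finiteIndex.2 hfi
  have aux : ∀ y : G, (ConjAct.toConjAct y • K N).relIndex (K N) ≠ 0 := by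
    intro y
    have hc : ConjAct.toConjAct y • K N = (ConjAct.toConjAct (proj y) • 𝒢).comap proj := by
      ext w
      rw [Subgroup.mem_pointwise_smul_iff_inv_smul_mem, Subgroup.mem_comap,
        Subgroup.mem_pointwise_smul_iff_inv_smul_mem, ← ConjAct.toConjAct_inv,
        ← ConjAct.toConjAct_inv, ConjAct.toConjAct_smul, ConjAct.toConjAct_smul]
      simp [K, 𝒢]
    have hA : (ConjAct.toConjAct (proj y) • 𝒢).IsArithmetic := Subgroup.IsArithmetic.conj 𝒢 y.mat
    have hcomm : Subgroup.Commensurable (ConjAct.toConjAct (proj y) • 𝒢) 𝒢 :=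
      hA.is_commensurable.trans hG.is_commensurable.symm
    rw [hc, Subgroup.relIndex_comap]
    refine fun h0 => hcomm.1 ?_
    exact Subgroup.relIndex_eq_zero_of_le_right (Subgroup.map_comap_le _ _) h0
  refine ⟨aux x, ?_⟩
  have h2 := (Subgroup.Commensurable.commensurable_inv (K N) (ConjAct.toConjAct x)).2
  have := Subgroup.relIndex_pointwise_smul (ConjAct.toConjAct x)⁻¹ (K N) (ConjAct.toConjAct x • K N)
  rw [inv_smul_smul] at this
  rw [← this]
  exact aux x⁻¹

lemma commensurable_conj_Delta0 (N : ℕ) [NeZero N] (x : G) :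
    Subgroup.Commensurable (ConjAct.toConjAct x • Delta0 N) (Delta0 N) :=
  (((commensurable_Delta0_K N).conj _).trans (commensurable_conj_K N x)).trans
    (commensurable_Delta0_K N).symm

lemma cosets_finite (N : ℕ) [NeZero N] (n : ℕ) (hn : 0 < n) : (cosets N n hn).Finite := by
  let H : Subgroup G := ConjAct.toConjAct (xi n hn)⁻¹ • Delta0 N
  have hfin : Finite (Delta0 N ⧸ H.subgroupOf (Delta0 N)) :=
    (Nat.finite_of_card_ne_zero (commensurable_conj_Delta0 N (xi n hn)⁻¹).1)
  let F : (Delta0 N ⧸ H.subgroupOf (Delta0 N)) → Quotient (QuotientGroup.rightRel (Delta0 N)) :=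
    fun q => Quotient.mk _ (xi n hn * (q.out : G)⁻¹)
  refine (Set.finite_range F).subset ?_
  rintro _ ⟨w, hw, rfl⟩
  obtain ⟨d', hd', d, hd, rfl⟩ := DoubleCoset.mem_doubleCoset.1 hw
  refine ⟨QuotientGroup.mk ⟨d⁻¹, inv_mem hd⟩, coset_eq.2 ?_⟩
  obtain ⟨h, hh⟩ := QuotientGroup.mk_out_eq_mul (H.subgroupOf (Delta0 N))
    (⟨d⁻¹, inv_mem hd⟩ : Delta0 N)
  rw [hh]
  have h1 : ((h : Delta0 N) : G) ∈ H := Subgroup.mem_subgroupOf.1 h.2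
  have h2 : (xi n hn) * ((h : Delta0 N) : G) * (xi n hn)⁻¹ ∈ Delta0 N := by
    have := (Subgroup.mem_pointwise_smul_iff_inv_smul_mem).1 h1
    rw [← ConjAct.toConjAct_inv, ConjAct.toConjAct_smul] at this
    simpa using this
  have h3 := mul_mem hd' h2
  convert h3 using 1
  push_cast
  group

/-! #### The operators preserve `M_{k/2}(N, χ)` -/

/-- Pairs whose matrix is integral with lower left entry divisible by `N`. -/
def IsInt (N : ℕ) (x : G) (A : Matrix (Fin 2) (Fin 2) ℤ) : Prop :=
  x.mat.1 = A.map (Int.cast : ℤ → ℚ) ∧ ((A 1 0 : ℤ) : ZMod N) = 0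

lemma IsInt.mul {N : ℕ} {x y : G} {A B : Matrix (Fin 2) (Fin 2) ℤ} (hx : IsInt N x A)
    (hy : IsInt N y B) : IsInt N (x * y) (A * B) := by
  refine ⟨?_, ?_⟩
  · rw [G.mul_mat, Units.val_mul, hx.1, hy.1]
    exact (Matrix.map_mul (f := Int.castRingHom ℚ)).symm
  · rw [Matrix.mul_apply, Fin.sum_univ_two]
    push_cast
    rw [hx.2, hy.2]
    ring

lemma IsInt.num {N : ℕ} {x : G} {A : Matrix (Fin 2) (Fin 2) ℤ} (hx : IsInt N x A) :
    (x.mat 0 0 : ℚ).num = A 0 0 := by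
  have : (x.mat 0 0 : ℚ) = (A 0 0 : ℚ) := by
    rw [hx.1, Matrix.map_apply]
  rw [this, Rat.num_intCast]

lemma IsInt.num_mul {N : ℕ} {x y : G} {A B : Matrix (Fin 2) (Fin 2) ℤ} (hx : IsInt N x A)
    (hy : IsInt N y B) : ((((x * y).mat 0 0 : ℚ).num : ℤ) : ZMod N) =
      ((A 0 0 : ℤ) : ZMod N) * ((B 0 0 : ℤ) : ZMod N) := by
  rw [(hx.mul hy).num, Matrix.mul_apply, Fin.sum_univ_two]
  push_cast
  rw [hy.2]
  ring

lemma isInt_xi (N n : ℕ) (hn : 0 < n) : IsInt N (xi n hn) !![1, 0; 0, (n : ℤ) ^ 2] := by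
  refine ⟨?_, by simp⟩
  ext i j
  fin_cases i <;> fin_cases j <;> simp [xi, GeneralLinearGroup.mkOfDetNeZero]

lemma Gam_unit {N : ℕ} {γ : SL(2, ℤ)} (hγ : γ ∈ Gam N) :
    ((γ 1 1 : ℤ) : ZMod N) * ((γ 0 0 : ℤ) : ZMod N) = 1 := by
  have h : ((γ 1 0 : ℤ) : ZMod N) = 0 := CongruenceSubgroup.Gamma0_mem.1 hγ.2
  have hdet := γ.det_coe
  rw [Matrix.det_fin_two] at hdet
  have := congrArg (Int.cast : ℤ → ZMod N) hdet
  push_cast at this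
  rw [h] at this
  linear_combination this

/-- Elements of `Δ₀(N)` act on `M_{k/2}(N, χ)` through `χ(d)`. -/
lemma slash_Delta0 {k N : ℕ} {χ : DirichletCharacter ℂ N} {f : ℍ → ℂ} (hf : f ∈ M k χ) {x : G}
    (hx : x ∈ Delta0 N) : ∃ γ ∈ Gam N, IsInt N x γ.1 ∧
      slash k x f = χ ((γ 1 1 : ℤ) : ZMod N) • f := by
  have isInt : ∀ (y : G) (γ : SL(2, ℤ)), γ ∈ Gam N → y.mat = SpecialLinearGroup.mapGL ℚ γ →
      IsInt N y γ.1 := by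
    intro y γ hγ h
    refine ⟨?_, CongruenceSubgroup.Gamma0_mem.1 hγ.2⟩
    rw [h]
    ext i j
    simp
  suffices h : ∃ γ ∈ Gam N, x.mat = SpecialLinearGroup.mapGL ℚ γ ∧
      slash k x f = χ ((γ 1 1 : ℤ) : ZMod N) • f by
    obtain ⟨γ, hγ, h1, h2⟩ := h
    exact ⟨γ, hγ, isInt x γ hγ h1, h2⟩
  induction hx using Subgroup.closure_induction with
  | mem x hx =>
    obtain ⟨γ, hγ, rfl⟩ := hx
    exact ⟨γ, ⟨γ.2, hγ⟩, rfl, hf.2 γ hγ⟩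
  | one => exact ⟨1, one_mem _, by rw [G.one_mat, map_one], by rw [slash_one]; simp⟩
  | mul x y _ _ hx hy =>
    obtain ⟨γ, hγ, h, e⟩ := hx
    obtain ⟨γ', hγ', h', e'⟩ := hy
    refine ⟨γ * γ', mul_mem hγ hγ', by rw [G.mul_mat, h, h', map_mul], ?_⟩
    have h0 : ((γ 1 0 : ℤ) : ZMod N) = 0 := CongruenceSubgroup.Gamma0_mem.1 hγ.2
    have hd : (((γ * γ') 1 1 : ℤ) : ZMod N) = ((γ 1 1 : ℤ) : ZMod N) * ((γ' 1 1 : ℤ) : ZMod N) := by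
      have h2 : (γ * γ') 1 1 = γ 1 0 * γ' 0 1 + γ 1 1 * γ' 1 1 := by
        change (γ.1 * γ'.1) 1 1 = _
        rw [Matrix.mul_apply, Fin.sum_univ_two]
      rw [h2]
      push_cast
      rw [h0]
      ring
    rw [slash_mul, e, map_smul, e', smul_smul, hd, map_mul]
  | inv x _ hx =>
    obtain ⟨γ, hγ, h, e⟩ := hx
    refine ⟨γ⁻¹, inv_mem hγ, by rw [G.inv_mat, h, map_inv], ?_⟩
    have hd : ((γ⁻¹) 1 1 : ℤ) = γ 0 0 := by
      rw [SpecialLinearGroup.SL2_inv_expl]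
      simp
    have hu : χ ((γ 1 1 : ℤ) : ZMod N) * χ ((γ 0 0 : ℤ) : ZMod N) = 1 := by
      rw [← map_mul, Gam_unit hγ, map_one]
    have h1 : slash k x⁻¹ (slash k x f) = f := by rw [← slash_mul, mul_inv_cancel, slash_one]
    rw [e, map_smul] at h1
    rw [hd]
    nth_rewrite 2 [← h1]
    rw [smul_smul, mul_comm, hu, one_smul]

lemma isInt_of_mem {N n : ℕ} {hn : 0 < n} {x : G}
    (hx : x ∈ DoubleCoset.doubleCoset (xi n hn) (Delta0 N : Set G) (Delta0 N)) :
    ∃ A, IsInt N x A := by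
  have aux : ∀ y ∈ Delta0 N, ∃ A, IsInt N y A := by
    intro y hy
    obtain ⟨γ, _, h, _⟩ := slash_Delta0 (k := 0) (χ := 1) (zero_mem _) hy
    exact ⟨_, h⟩
  obtain ⟨d, hd, d', hd', rfl⟩ := DoubleCoset.mem_doubleCoset.1 hx
  obtain ⟨A, hA⟩ := aux d hd
  obtain ⟨B, hB⟩ := aux d' hd'
  exact ⟨_, (hA.mul (isInt_xi N n hn)).mul hB⟩

/-- The summands do not depend on the choice of coset representatives. -/
lemma term_left {k N : ℕ} {χ : DirichletCharacter ℂ N} {f : ℍ → ℂ} (hf : f ∈ M k χ) {x d : G}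
    {A : Matrix (Fin 2) (Fin 2) ℤ} (hx : IsInt N x A) (hd : d ∈ Delta0 N) :
    term k χ (d * x) f = term k χ x f := by
  obtain ⟨γ, hγ, h, e⟩ := slash_Delta0 hf hd
  have hu : χ ((γ 1 1 : ℤ) : ZMod N) * χ ((γ 0 0 : ℤ) : ZMod N) = 1 := by
    rw [← map_mul, Gam_unit hγ, map_one]
  simp only [term, LinearMap.smul_apply]
  rw [h.num_mul hx, hx.num, slash_mul, e, map_smul, smul_smul, map_mul]
  congr 1
  linear_combination χ ((A 0 0 : ℤ) : ZMod N) * hu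

lemma term_right {k N : ℕ} {χ : DirichletCharacter ℂ N} (f : ℍ → ℂ) {x d : G}
    {A : Matrix (Fin 2) (Fin 2) ℤ} (hx : IsInt N x A) {γ : SL(2, ℤ)} (hγ : γ ∈ Gam N)
    (hd : IsInt N d γ.1) :
    slash k d (term k χ x f) = χ ((γ 1 1 : ℤ) : ZMod N) • term k χ (x * d) f := by
  have hu : χ ((γ 1 1 : ℤ) : ZMod N) * χ ((γ 0 0 : ℤ) : ZMod N) = 1 := by
    rw [← map_mul, Gam_unit hγ, map_one]
  simp only [term, LinearMap.smul_apply]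
  rw [hx.num_mul hd, hx.num, slash_mul, map_smul, smul_smul, map_mul]
  congr 1
  linear_combination (-χ ((A 0 0 : ℤ) : ZMod N)) * hu

lemma slash_mem_holoCusps {k : ℕ} {f : ℍ → ℂ} (hf : f ∈ holoCusps k) (x : G) :
    slash k x f ∈ holoCusps k := by
  refine ⟨?_, fun y => by rw [← slash_mul]; exact hf.2 (x * y)⟩
  refine (hf.1.comp (mdifferentiable_smul x.det_pos_real)).mul ?_
  intro z
  have h2 : DifferentiableAt ℂ (fun w : ℂ => (w ^ k)⁻¹) (x.phi z) :=
    (differentiableAt_id.pow k).inv (pow_ne_zero _ (x.phi_ne z))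
  exact h2.mdifferentiableAt.comp z (x.holo z)

lemma out_mem {N n : ℕ} {hn : 0 < n} {c : Quotient (QuotientGroup.rightRel (Delta0 N))}
    (hc : c ∈ cosets N n hn) :
    c.out ∈ DoubleCoset.doubleCoset (xi n hn) (Delta0 N : Set G) (Delta0 N) := by
  obtain ⟨w, hw, rfl⟩ := hc
  obtain ⟨d', hd', d, hd, rfl⟩ := DoubleCoset.mem_doubleCoset.1 hw
  obtain ⟨e, he, h⟩ := coset_out (N := N) (d' * xi n hn * d)
  exact DoubleCoset.mem_doubleCoset.2 ⟨e * d', mul_mem he hd', d, hd, by rw [h]; group⟩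

/-- The sum `∑_ν χ(a_ν) f|[ξ_ν]_{k/2}` over representatives `ξ_ν` of the right cosets of `Δ₀(N)`
in `Δ₀(N) ξ Δ₀(N)`. The representatives are chosen arbitrarily. -/
def cosetSum (k : ℕ) {N : ℕ} [NeZero N] (χ : DirichletCharacter ℂ N) (n : ℕ) (hn : 0 < n) :
    (ℍ → ℂ) →ₗ[ℂ] (ℍ → ℂ) :=
  ∑ c ∈ (cosets_finite N n hn).toFinset, term k χ c.out

lemma cosetSum_mem {k N : ℕ} [NeZero N] {χ : DirichletCharacter ℂ N} {n : ℕ} {hn : 0 < n}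
    {f : ℍ → ℂ} (hf : f ∈ M k χ) : cosetSum k χ n hn f ∈ M k χ := by
  refine ⟨?_, fun γ hγ => ?_⟩
  · rw [cosetSum, LinearMap.sum_apply]
    exact Submodule.sum_mem _ fun c _ =>
      Submodule.smul_mem _ _ (slash_mem_holoCusps hf.1 _)
  · have hd : tilde γ ∈ Delta0 N := Subgroup.subset_closure ⟨γ, hγ, rfl⟩
    have hG : (γ : SL(2, ℤ)) ∈ Gam N := ⟨γ.2, hγ⟩
    have hI : IsInt N (tilde γ) (γ : SL(2, ℤ)).1 := by
      refine ⟨?_, CongruenceSubgroup.Gamma0_mem.1 hγ⟩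
      ext i j
      simp [tilde]
    rw [cosetSum, LinearMap.sum_apply, map_sum, Finset.smul_sum]
    let S := (cosets_finite N n hn).toFinset
    have hS : ∀ {c}, c ∈ S → c ∈ cosets N n hn := fun {c} hc =>
      (cosets_finite N n hn).mem_toFinset.1 hc
    have mkS : ∀ (d : G) {c}, d ∈ Delta0 N → c ∈ S →
        (Quotient.mk (QuotientGroup.rightRel (Delta0 N)) (c.out * d)) ∈ S := by
      intro d c hd hc
      refine (cosets_finite N n hn).mem_toFinset.2 ⟨_, ?_, rfl⟩
      obtain ⟨a, ha, b, hb, e⟩ := DoubleCoset.mem_doubleCoset.1 (out_mem (hS hc))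
      exact DoubleCoset.mem_doubleCoset.2 ⟨a, ha, b * d, mul_mem hb hd, by rw [e]; group⟩
    have inv_aux : ∀ (d : G) (c : Quotient (QuotientGroup.rightRel (Delta0 N))),
        Quotient.mk (QuotientGroup.rightRel (Delta0 N))
          ((Quotient.mk (QuotientGroup.rightRel (Delta0 N)) (c.out * d)).out * d⁻¹) = c := by
      intro d c
      obtain ⟨e, he, h⟩ := coset_out (N := N) (c.out * d)
      rw [h]
      nth_rewrite 2 [← Quotient.out_eq c]
      refine coset_eq.2 ?_
      have : c.out * (e * (c.out * d) * d⁻¹)⁻¹ = e⁻¹ := by group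
      rw [this]
      exact inv_mem he
    refine Finset.sum_bij'
      (fun c _ => Quotient.mk (QuotientGroup.rightRel (Delta0 N)) (c.out * tilde γ))
      (fun c _ => Quotient.mk (QuotientGroup.rightRel (Delta0 N)) (c.out * (tilde γ)⁻¹))
      (fun c hc => mkS _ hd hc) (fun c hc => mkS _ (inv_mem hd) hc)
      (fun c _ => inv_aux _ c)
      (fun c _ => by simpa using inv_aux (tilde γ)⁻¹ c) ?_
    intro c hc
    obtain ⟨A, hA⟩ := isInt_of_mem (out_mem (hS hc))
    obtain ⟨e, he, h⟩ := coset_out (N := N) (c.out * tilde γ)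
    rw [term_right f hA hG hI, h, term_left hf (hA.mul hI) he]

/-- The Hecke operator `T_{n²}` on `M_{k/2}(N, χ)`:
`T_{n²} f = n^{k/2 - 2} ∑_ν χ(a_ν) f|[ξ_ν]_{k/2}`, where the `ξ_ν` represent the right cosets of
`Δ₀(N)` in `Δ₀(N) ξ Δ₀(N)`, `ξ = ((1 0; 0 n²), n^{1/2})`, and `a_ν` is the upper left entry of
`ξ_ν`. So `heckeSq k χ (p ^ ℓ) _` is `T_{p^{2ℓ}}`. -/
def heckeSq (k : ℕ) {N : ℕ} [NeZero N] (χ : DirichletCharacter ℂ N) (n : ℕ) (hn : 0 < n) :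
    Module.End ℂ (M k χ) :=
  ((((n : ℝ) ^ ((k : ℝ) / 2 - 2) : ℝ) : ℂ) • cosetSum k χ n hn).restrict
    fun _ hf => Submodule.smul_mem _ _ (cosetSum_mem hf)

/-! ### The coefficients -/

/-- `A_{r,ℓ}(m)` for `r ≥ 1` (with the irrelevant value `0` at `r = 0`). -/
def A : ℕ → ℕ → ℕ → ℤ
  | 0, _, _ => 0
  | 1, _, _ => 1
  | r + 2, l, m => A (r + 1) l m - ((l - 2 * (r + 1)).choose (m - (r + 1)) : ℤ) * A (r + 1) l (r + 1)

/-- `B_{r,ℓ}(m)` for `r ≥ 1` (with the irrelevant value `0` at `r = 0`). -/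
def B : ℕ → ℕ → ℕ → ℤ
  | 0, _, _ => 0
  | 1, l, m => (l.choose m : ℤ) - 1
  | r + 2, l, m => B (r + 1) l m - ((l - 2 * (r + 1)).choose (m - (r + 1)) : ℤ) * B (r + 1) l (r + 1)

/-- `α_{r,ℓ} = A_{r,ℓ}(r)`. -/
def α (r l : ℕ) : ℤ := A r l r

/-- `β_{r,ℓ} = B_{r,ℓ}(r)`. -/
def β (r l : ℕ) : ℤ := B r l r

end HalfIntegral

end

/-! Formally, write `T_{p²}` as `a + b` with `ab = c`, where `c = χ(p)² p^(k-2)`. The claim is that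
`T_{p^{2l}}` is `h_l(a,b) - p⁻¹ ab h_{l-2}(a,b)` for `l ≥ 2`, with `h` the complete homogeneous
symmetric polynomials. The recursions for `A` and `B` are the elimination expressing symmetric forms
through `ab` and `a + b`: starting from coefficients `1` they expand `ab h_{l-2}`, starting from
`binom(l,m) - 1` they expand `(a+b)^l - h_l` (`sum_symm_eq`, `sum_A`, `sum_B`). Hence it suffices to
prove `T₁² = T₂ + c + c/p` and `T₁ T_{l+2} = T_{l+3} + c T_{l+1}` for `T_l = T_{p^{2l}}`
(`eq_aeval_heckePoly`).

These relations are proved on all `1`-periodic functions. The cosets have upper triangular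
representatives `(p^i h; 0 p^(2l-i))`, with `p ∤ h` for `0 < i < 2l`, and a quadratic character in
`h` appears for odd `i` (`exists_rep`, `cosetSum_eq`). So `T_l` is a combination of words in `u =
atk`, `v = dil` and `w = twist` (`toPer_heckeSq`). The recurrence then follows formally from `uv =
p`, `uw = 0`, `wv = 0` and `w² = (-1/p)(p - vu)` (`hecke_one_mul`, `hecke_one_sq`).

The cocycle identity for `j(γ, z)` is never proved. A nonzero form of odd weight already forces
`Δ₀(N) → SL₂(ℤ)` to be injective (`eq_one_of_mem_Delta0`), and if there is no such form the theorem
is trivial. -/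

noncomputable section

namespace HalfIntegral

/-! ### The coefficients and the Chebyshev recurrence -/

/-- Expansion of a symmetric binary form in powers of `ab` and `a + b`, by repeatedly subtracting
a multiple of `(ab)^r (a + b)^{l - 2r}` to cancel the extreme coefficients. -/
lemma sum_symm_eq {R : Type*} [CommRing R] (a b : R) (l : ℕ) (S : ℕ → ℕ → ℤ)
    (hS : ∀ r m, 1 ≤ r → S (r + 1) m = S r m - ((l - 2 * r).choose (m - r) : ℤ) * S r r)
    (hsymm : ∀ m, 1 ≤ m → m + 1 ≤ l → S 1 (l - m) = S 1 m) :
    ∑ m ∈ Finset.Icc 1 (l - 1), (S 1 m : R) * (a ^ m * b ^ (l - m)) =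
      ∑ r ∈ Finset.Icc 1 (l / 2), (S r r : R) * ((a * b) ^ r * (a + b) ^ (l - 2 * r)) := by
  have symm : ∀ r, 1 ≤ r → ∀ m, r ≤ m → m + r ≤ l → S r (l - m) = S r m := by
    intro r hr
    induction r, hr using Nat.le_induction with
    | base => exact hsymm
    | succ r hr ih =>
      intro m h1 h2
      rw [hS r _ hr, hS r _ hr, ih m (by omega) (by omega),
        ← Nat.choose_symm (n := l - 2 * r) (k := m - r) (by omega)]
      congr 4
      omega
  -- Stage `r` has cancelled the outer coefficients, leaving `r ≤ m ≤ l - r`. The bound `2r ≤ l + 2`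
  -- lets `r` reach `l / 2 + 1`, where nothing is left.
  have key : ∀ r, 1 ≤ r → 2 * r ≤ l + 2 →
      ∑ m ∈ Finset.Icc 1 (l - 1), (S 1 m : R) * (a ^ m * b ^ (l - m)) =
      ∑ s ∈ Finset.Ico 1 r, (S s s : R) * ((a * b) ^ s * (a + b) ^ (l - 2 * s)) +
      ∑ m ∈ Finset.Ico r (l + 1 - r), (S r m : R) * (a ^ m * b ^ (l - m)) := by
    intro r hr
    induction r, hr using Nat.le_induction with
    | base =>
      intro _
      rw [Finset.Ico_self, Finset.sum_empty, zero_add]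
      refine Finset.sum_congr ?_ fun _ _ => rfl
      ext m
      simp only [Finset.mem_Icc, Finset.mem_Ico]
      omega
    | succ r hr ih =>
      intro h
      rw [ih (by omega), Finset.sum_Ico_succ_top hr, add_assoc]
      congr 1
      have hbin : (a * b) ^ r * (a + b) ^ (l - 2 * r) = ∑ m ∈ Finset.Ico r (l + 1 - r),
          ((l - 2 * r).choose (m - r) : R) * (a ^ m * b ^ (l - m)) := by
        rw [add_pow, Finset.mul_sum, Finset.sum_Ico_eq_sum_range,
          show l + 1 - r - r = l - 2 * r + 1 by omega]
        refine Finset.sum_congr rfl fun m hm => ?_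
        have hm' := Finset.mem_range.1 hm
        rw [show l - (r + m) = r + (l - 2 * r - m) by omega, Nat.add_sub_cancel_left]
        ring
      rw [hbin, Finset.mul_sum, ← sub_eq_iff_eq_add', ← Finset.sum_sub_distrib]
      have hsub : Finset.Ico (r + 1) (l + 1 - (r + 1)) ⊆ Finset.Ico r (l + 1 - r) :=
        Finset.Ico_subset_Ico (by omega) (by omega)
      rw [← Finset.sum_subset hsub]
      · refine Finset.sum_congr rfl fun m _ => ?_
        rw [hS r m hr]
        push_cast
        ring
      · intro m hm hm'
        rw [Finset.mem_Ico] at hm hm'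
        -- At both ends the binomial coefficient is `1`, and `S r` takes the same value there by
        -- symmetry, so one subtraction removes both ends.
        have : S r m = ((l - 2 * r).choose (m - r) : ℤ) * S r r := by
          rcases (by omega : m = r ∨ m = l - r) with rfl | rfl
          · simp
          · rw [symm r hr r le_rfl (by omega), show l - r - r = l - 2 * r by omega]
            simp
        rw [this]
        push_cast
        ring
  rw [key (l / 2 + 1) (by omega) (by omega),
    Finset.Ico_eq_empty (a := l / 2 + 1) (b := l + 1 - (l / 2 + 1)) (by omega), Finset.sum_empty,
    add_zero]
  rfl

/-- The complete homogeneous symmetric polynomial of degree `n` in two variables. -/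
def hom2 (a b : ℂ) (n : ℕ) : ℂ := ∑ m ∈ Finset.range (n + 1), a ^ m * b ^ (n - m)

lemma hom2_succ (a b : ℂ) (n : ℕ) : hom2 a b (n + 1) = b * hom2 a b n + a ^ (n + 1) := by
  rw [hom2, Finset.sum_range_succ, hom2, Finset.mul_sum, Nat.sub_self, pow_zero, mul_one]
  congr 1
  refine Finset.sum_congr rfl fun m hm => ?_
  rw [Nat.succ_sub (Nat.lt_succ_iff.1 (Finset.mem_range.1 hm)), pow_succ]
  ring

lemma hom2_rec (a b : ℂ) (n : ℕ) :
    hom2 a b (n + 2) = (a + b) * hom2 a b (n + 1) - a * b * hom2 a b n := by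
  rw [hom2_succ a b (n + 1), hom2_succ a b n]
  ring

lemma sum_A (a b : ℂ) (l : ℕ) :
    ∑ r ∈ Finset.Icc 1 ((l + 2) / 2), (α r (l + 2) : ℂ) *
      ((a * b) ^ r * (a + b) ^ (l + 2 - 2 * r)) = a * b * hom2 a b l := by
  have h := sum_symm_eq a b (l + 2) (fun r m => A r (l + 2) m)
    (fun r m hr => by obtain ⟨r, rfl⟩ := Nat.exists_eq_add_of_le' hr; rfl)
    (fun m _ _ => rfl)
  refine h.symm.trans ?_
  rw [hom2, Finset.mul_sum, ← Finset.Ico_succ_right_eq_Icc, Finset.sum_Ico_eq_sum_range]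
  refine Finset.sum_congr rfl fun m hm => ?_
  have hm' : m ≤ l := Nat.lt_succ_iff.1 (Finset.mem_range.1 hm)
  rw [show l + 2 - (1 + m) = l - m + 1 by omega]
  simp only [A]
  push_cast
  ring

/-- The two extreme coefficients of `(a + b)^n - h_n` vanish; the inner ones are `binom(n,m) - 1`,
the starting row of `B`. -/
lemma sum_B (a b : ℂ) (l : ℕ) :
    ∑ r ∈ Finset.Icc 1 ((l + 2) / 2), (β r (l + 2) : ℂ) *
      ((a * b) ^ r * (a + b) ^ (l + 2 - 2 * r)) = (a + b) ^ (l + 2) - hom2 a b (l + 2) := by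
  have h := sum_symm_eq a b (l + 2) (fun r m => B r (l + 2) m)
    (fun r m hr => by obtain ⟨r, rfl⟩ := Nat.exists_eq_add_of_le' hr; rfl)
    (fun m _ hm => by simp only [B]; rw [Nat.choose_symm (by omega)])
  refine h.symm.trans ?_
  rw [add_pow, hom2, ← Finset.sum_sub_distrib, Finset.sum_range_succ, Finset.sum_range_succ',
    ← Finset.Ico_succ_right_eq_Icc, Finset.sum_Ico_eq_sum_range]
  simp only [Nat.choose_zero_right, Nat.choose_self, Nat.cast_one, mul_one, sub_self, add_zero]
  refine Finset.sum_congr rfl fun m _ => ?_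
  rw [add_comm 1 m]
  simp only [B]
  push_cast
  ring

/-- The polynomial expressing `T_{p^{2l}}` through `T_{p²}`. -/
def heckePoly (c q : ℂ) (l : ℕ) : Polynomial ℂ :=
  Polynomial.X ^ l - ∑ r ∈ Finset.Icc 1 (l / 2),
    Polynomial.C (c ^ r * (q * (α r l : ℂ) + (β r l : ℂ))) * Polynomial.X ^ (l - 2 * r)

lemma heckePoly_one (c q : ℂ) : heckePoly c q 1 = Polynomial.X := by simp [heckePoly]

lemma heckePoly_eval (a b q : ℂ) (l : ℕ) :
    (heckePoly (a * b) q (l + 2)).eval (a + b) =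
      hom2 a b (l + 2) - q * (a * b * hom2 a b l) := by
  rw [← sum_A, ← sub_sub_cancel ((a + b) ^ (l + 2)) (hom2 a b (l + 2)), ← sum_B, heckePoly]
  simp only [Polynomial.eval_sub, Polynomial.eval_pow, Polynomial.eval_X,
    Polynomial.eval_finsetSum, Polynomial.eval_mul, Polynomial.eval_C]
  rw [sub_sub, Finset.mul_sum, ← Finset.sum_add_distrib]
  congr 1
  refine Finset.sum_congr rfl fun r _ => ?_
  ring

/-- Every point of `ℂ` is thus of the form `a + b` with `ab = c`, so identities between the
`heckePoly c q l` can be checked through `heckePoly_eval`. -/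
lemma exists_add_mul_eq (x c : ℂ) : ∃ a b : ℂ, a + b = x ∧ a * b = c := by
  obtain ⟨s, hs⟩ := IsAlgClosed.exists_pow_nat_eq (x ^ 2 - 4 * c) (n := 2) (by norm_num)
  exact ⟨(x + s) / 2, (x - s) / 2, by ring, by linear_combination (-1 / 4) * hs⟩

lemma heckePoly_two (c q : ℂ) :
    heckePoly c q 2 = Polynomial.X ^ 2 - Polynomial.C (c + q * c) := by
  refine Polynomial.funext fun x => ?_
  obtain ⟨a, b, rfl, rfl⟩ := exists_add_mul_eq x c
  rw [heckePoly_eval a b q 0]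
  simp [hom2, Finset.sum_range_succ]
  ring

/-- Separate from the general recurrence because `heckePoly c q 1` is outside the range of
`heckePoly_eval`. -/
lemma heckePoly_three (c q : ℂ) : heckePoly c q 3 =
    Polynomial.X * heckePoly c q 2 - Polynomial.C c * heckePoly c q 1 := by
  refine Polynomial.funext fun x => ?_
  obtain ⟨a, b, rfl, rfl⟩ := exists_add_mul_eq x c
  rw [heckePoly_one, Polynomial.eval_sub, Polynomial.eval_mul, Polynomial.eval_mul,
    heckePoly_eval a b q 1, heckePoly_eval a b q 0]
  simp [hom2, Finset.sum_range_succ]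
  ring

lemma heckePoly_rec (c q : ℂ) (l : ℕ) : heckePoly c q (l + 3) =
    Polynomial.X * heckePoly c q (l + 2) - Polynomial.C c * heckePoly c q (l + 1) := by
  cases l with
  | zero => exact heckePoly_three c q
  | succ l =>
    refine Polynomial.funext fun x => ?_
    obtain ⟨a, b, rfl, rfl⟩ := exists_add_mul_eq x c
    rw [Polynomial.eval_sub, Polynomial.eval_mul, Polynomial.eval_mul,
      heckePoly_eval a b q (l + 2), heckePoly_eval a b q (l + 1), heckePoly_eval a b q l,
      hom2_rec a b (l + 2), hom2_rec a b l]
    simp only [Polynomial.eval_X, Polynomial.eval_C]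
    ring

lemma eq_aeval_heckePoly {E : Type*} [Ring E] [Algebra ℂ E] (T : ℕ → E) (c q : ℂ)
    (h2 : T 1 * T 1 = T 2 + algebraMap ℂ E (c + q * c))
    (hrec : ∀ l, T 1 * T (l + 2) = T (l + 3) + algebraMap ℂ E c * T (l + 1)) (l : ℕ) :
    T (l + 1) = Polynomial.aeval (T 1) (heckePoly c q (l + 1)) := by
  induction l using Nat.strong_induction_on with
  | _ l ih =>
    match l, ih with
    | 0, _ => rw [heckePoly_one, Polynomial.aeval_X]
    | 1, _ =>
      rw [heckePoly_two, map_sub, map_pow, Polynomial.aeval_X, Polynomial.aeval_C, sq, h2,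
        add_sub_cancel_right]
    | l + 2, ih =>
      rw [heckePoly_rec, map_sub, map_mul, map_mul, Polynomial.aeval_X, Polynomial.aeval_C,
        ← ih (l + 1) (by omega), ← ih l (by omega), hrec, add_sub_cancel_right]

/-! ### Operators on periodic functions -/

/-- The `1`-periodic functions on `ℂ`. -/
def Per : Submodule ℂ (ℂ → ℂ) where
  carrier := {F | Function.Periodic F 1}
  add_mem' hf hg := hf.add hg
  zero_mem' _ := rfl
  smul_mem' c _ hf := hf.smul c

namespace Per

lemma add_nat (F : Per) (z : ℂ) (m : ℕ) : F.1 (z + m) = F.1 z := by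
  simpa using (Function.Periodic.nat_mul F.2 m) z

variable (p : ℕ) [hp : Fact p.Prime]

lemma p_ne : (p : ℂ) ≠ 0 := Nat.cast_ne_zero.2 hp.out.ne_zero

/-- By periodicity, translation by `m/p` depends only on `m` modulo `p`; this makes `ZMod p` a
legitimate index set for shifts. -/
lemma add_mod_div (F : Per) (z : ℂ) (m : ℕ) :
    F.1 (z + (m % p : ℕ) / p) = F.1 (z + m / p) := by
  have h : (m : ℂ) / p = (m % p : ℕ) / p + (m / p : ℕ) := by
    have h1 : (m : ℂ) = (m % p : ℕ) + p * (m / p : ℕ) := by exact_mod_cast (Nat.mod_add_div m p).symm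
    have := p_ne p
    nth_rewrite 1 [h1]
    field_simp
  rw [h, ← add_assoc, add_nat]

lemma add_val_div (F : Per) (z : ℂ) (a b : ZMod p) :
    F.1 (z + (a + b).val / p) = F.1 (z + a.val / p + b.val / p) := by
  rw [ZMod.val_add, add_mod_div, Nat.cast_add, add_div, add_assoc]

/-- `F(z) ↦ F(z + a/p)`. -/
def shift (a : ZMod p) : Module.End ℂ Per where
  toFun F := ⟨fun z => F.1 (z + a.val / p), fun z => by
    dsimp only
    rw [add_right_comm]
    exact F.2 _⟩
  map_add' _ _ := rfl
  map_smul' _ _ := rfl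

/-- `F(z) ↦ F(pz)`. -/
def dil : Module.End ℂ Per where
  toFun F := ⟨fun z => F.1 (p * z), fun z => by
    dsimp only
    rw [mul_add, mul_one]
    exact add_nat F _ p⟩
  map_add' _ _ := rfl
  map_smul' _ _ := rfl

/-- A shift permutes the terms. This gives both the periodicity of `atk p F` and the absorption of
shifts by `atk`. -/
lemma sum_shift_val (F : Per) (z : ℂ) (b : ZMod p) :
    ∑ a : ZMod p, F.1 (z + b.val / p + a.val / p) = ∑ a : ZMod p, F.1 (z + a.val / p) := by
  simp_rw [← add_val_div]
  exact Fintype.sum_equiv (Equiv.addLeft b) _ _ fun _ => rfl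

/-- `F(z) ↦ ∑_{a mod p} F((z + a)/p)`. -/
def atk : Module.End ℂ Per where
  toFun F := ⟨fun z => ∑ a : ZMod p, F.1 (z / p + a.val / p), fun z => by
    have := sum_shift_val p F (z / p) 1
    have hv : (1 : ZMod p).val = 1 := ZMod.val_one p
    rw [hv] at this
    dsimp only
    rw [← this, add_div, Nat.cast_one]⟩
  map_add' F F' := by
    ext z
    simp [Finset.sum_add_distrib]
  map_smul' c F := by
    ext z
    simp [Finset.mul_sum]

omit hp in
lemma shift_apply (a : ZMod p) (F : Per) (z : ℂ) : (shift p a F).1 z = F.1 (z + a.val / p) := rfl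
omit hp in
lemma dil_apply (F : Per) (z : ℂ) : (dil p F).1 z = F.1 (p * z) := rfl
lemma atk_apply (F : Per) (z : ℂ) :
    (atk p F).1 z = ∑ a : ZMod p, F.1 (z / p + a.val / p) := rfl

lemma sum_apply {ι : Type*} (s : Finset ι) (g : ι → Module.End ℂ Per) (F : Per) (z : ℂ) :
    ((∑ i ∈ s, g i) F).1 z = ∑ i ∈ s, (g i F).1 z := by
  simp

lemma hom_ext {S T : Module.End ℂ Per} (h : ∀ F z, (S F).1 z = (T F).1 z) : S = T :=
  LinearMap.ext fun F => Subtype.ext (funext (h F))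

lemma shift_mul_shift (a b : ZMod p) : shift p a * shift p b = shift p (a + b) :=
  hom_ext fun F z => by
    rw [shift_apply, add_val_div]
    rfl

lemma shift_zero : shift p 0 = 1 := hom_ext fun F z => by simp [shift_apply]

lemma shift_mul_dil (a : ZMod p) : shift p a * dil p = dil p := hom_ext fun F z => by
  rw [Module.End.mul_apply, shift_apply, dil_apply, dil_apply, mul_add,
    mul_div_cancel₀ _ (p_ne p), add_nat]

lemma atk_mul_shift (b : ZMod p) : atk p * shift p b = atk p := hom_ext fun F z => by
  rw [Module.End.mul_apply, atk_apply, atk_apply, ← sum_shift_val p F (z / p) b]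
  simp only [shift_apply]
  exact Finset.sum_congr rfl fun a _ => by rw [add_right_comm]

lemma atk_mul_dil : atk p * dil p = (p : ℂ) • 1 := hom_ext fun F z => by
  have h : ∀ a : ZMod p, (p : ℂ) * (z / p + a.val / p) = z + a.val := fun a => by
    have := p_ne p
    field_simp
  rw [Module.End.mul_apply, atk_apply]
  simp only [dil_apply, h, add_nat]
  simp

lemma dil_mul_atk : dil p * atk p = ∑ a, shift p a := hom_ext fun F z => by
  rw [sum_apply, Module.End.mul_apply, dil_apply, atk_apply, mul_div_cancel_left₀ _ (p_ne p)]
  rfl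

/-! ### Quadratic character sums and the twist -/

/-- The quadratic character modulo `p`, with complex values. -/
def quad (a : ZMod p) : ℂ := (quadraticChar (ZMod p) a : ℤ)

lemma quad_mul (a b : ZMod p) : quad p (a * b) = quad p a * quad p b := by
  unfold quad
  rw [map_mul, Int.cast_mul]

lemma quad_sq {a : ZMod p} (ha : a ≠ 0) : quad p a ^ 2 = 1 := by
  unfold quad
  exact_mod_cast quadraticChar_sq_one ha

lemma quad_sum (hp2 : p ≠ 2) : ∑ a, quad p a = 0 := by
  unfold quad
  rw [← Int.cast_sum, quadraticChar_sum_zero (by rwa [ZMod.ringChar_zmod_n]), Int.cast_zero]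

/-- For `s ≠ 0` the substitution `a ↦ sa` reduces to the Jacobi sum of the quadratic character with
its inverse, which is `-quad p (-1)`. For `s = 0` each of the `p - 1` nonzero terms is `quad p
(-1)`. -/
lemma quad_conv (hp2 : p ≠ 2) (s : ZMod p) :
    ∑ a, quad p a * quad p (s - a) = quad p (-1) * ((if s = 0 then (p : ℂ) else 0) - 1) := by
  have hsq : ∀ a : ZMod p, quad p a * quad p a = 1 - if a = 0 then 1 else 0 := fun a => by
    by_cases ha : a = 0
    · simp [ha, quad]
    · simp [ha, ← sq, quad_sq]
  by_cases hs : s = 0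
  · subst hs
    have : ∀ a : ZMod p, quad p a * quad p (0 - a) = quad p (-1) * (1 - if a = 0 then 1 else 0) :=
      fun a => by
        rw [← hsq, zero_sub, ← neg_one_mul a, quad_mul]
        ring
    simp_rw [this, ← Finset.mul_sum, Finset.sum_sub_distrib]
    simp
  · have hne : quadraticChar (ZMod p) ≠ 1 := quadraticChar_ne_one (by rwa [ZMod.ringChar_zmod_n])
    have h1 := jacobiSum_nontrivial_inv hne
    rw [(quadraticChar_isQuadratic (ZMod p)).inv, jacobiSum] at h1
    have h2 : ∑ a, quad p a * quad p (1 - a) = - quad p (-1) := by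
      unfold quad
      exact_mod_cast h1
    rw [if_neg hs, zero_sub, mul_neg_one, ← h2]
    refine (Fintype.sum_equiv (Equiv.mulLeft₀ s hs) _ _ fun a => ?_).symm
    have : s - s * a = s * (1 - a) := by ring
    simp only [Equiv.mulLeft₀_apply, this, quad_mul]
    linear_combination (-(quad p a * quad p (1 - a))) * quad_sq p hs

/-- `F(z) ↦ ∑_{a mod p} (a/p) F(z + a/p)`. -/
def twist : Module.End ℂ Per := ∑ a, quad p a • shift p a

lemma atk_mul_twist (hp2 : p ≠ 2) : atk p * twist p = 0 := by
  simp_rw [twist, Finset.mul_sum, mul_smul_comm, atk_mul_shift, ← Finset.sum_smul, quad_sum p hp2,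
    zero_smul]

lemma twist_mul_dil (hp2 : p ≠ 2) : twist p * dil p = 0 := by
  simp_rw [twist, Finset.sum_mul, smul_mul_assoc, shift_mul_dil, ← Finset.sum_smul, quad_sum p hp2,
    zero_smul]

/-- The square of a Gauss sum, computed in the group ring of `ZMod p`: the coefficient at `s` is the
convolution `quad_conv`. -/
lemma sum_quad_mul_sum_quad {E : Type*} [Ring E] [Algebra ℂ E] (hp2 : p ≠ 2) (sh : ZMod p → E)
    (h0 : sh 0 = 1) (hadd : ∀ a b, sh a * sh b = sh (a + b)) :
    (∑ a, quad p a • sh a) * ∑ a, quad p a • sh a =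
      quad p (-1) • ((p : ℂ) • 1 - ∑ a, sh a) := by
  have h : (∑ a, quad p a • sh a) * ∑ a, quad p a • sh a =
      ∑ s, (∑ a, quad p a * quad p (s - a)) • sh s := by
    simp_rw [Finset.sum_mul_sum, Finset.sum_smul]
    rw [Finset.sum_comm (f := fun s a => (quad p a * quad p (s - a)) • sh s)]
    refine Finset.sum_congr rfl fun a _ => ?_
    refine Fintype.sum_equiv (Equiv.addLeft a) _ _ fun b => ?_
    simp [hadd, smul_smul, mul_comm (quad p b)]
  rw [h]
  simp_rw [quad_conv p hp2, mul_smul, ← Finset.smul_sum, sub_smul, Finset.sum_sub_distrib, one_smul]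
  rw [Finset.sum_eq_single 0 (fun s _ hs => by rw [if_neg hs, zero_smul]) (by simp), if_pos rfl, h0]

lemma twist_mul_twist (hp2 : p ≠ 2) :
    twist p * twist p = quad p (-1) • ((p : ℂ) • 1 - dil p * atk p) := by
  rw [dil_mul_atk]
  exact sum_quad_mul_sum_quad p hp2 (shift p) (shift_zero p) (shift_mul_shift p)

/-! ### Words in `dil`, `twist` and `atk` as explicit sums over residues -/

section Sums

lemma sum_range_mul {A : Type*} [AddCommMonoid A] (m n : ℕ) (f : ℕ → A) :
    ∑ x ∈ Finset.range (m * n), f x =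
      ∑ b ∈ Finset.range n, ∑ a ∈ Finset.range m, f (a + m * b) := by
  induction n with
  | zero => simp
  | succ n ih =>
    rw [Nat.mul_succ, Finset.sum_range_add, ih, Finset.sum_range_succ]
    congr 1
    exact Finset.sum_congr rfl fun a _ => by rw [add_comm]

lemma sum_zmod {A : Type*} [AddCommMonoid A] (f : ℕ → A) :
    ∑ a : ZMod p, f a.val = ∑ a ∈ Finset.range p, f a := by
  refine Finset.sum_bij (fun a _ => a.val) (fun a _ => Finset.mem_range.2 a.val_lt)
    (fun a _ b _ h => ZMod.val_injective p h)
    (fun b hb => ⟨b, Finset.mem_univ _, ZMod.val_cast_of_lt (Finset.mem_range.1 hb)⟩)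
    fun _ _ => rfl

omit hp in
lemma dil_pow_apply (i : ℕ) (F : Per) (z : ℂ) : ((dil p ^ i) F).1 z = F.1 (p ^ i * z) := by
  induction i generalizing z with
  | zero => simp
  | succ i ih => rw [pow_succ', Module.End.mul_apply, dil_apply, ih, pow_succ, mul_assoc]

lemma atk_pow_apply (j : ℕ) (F : Per) (z : ℂ) :
    ((atk p ^ j) F).1 z = ∑ h ∈ Finset.range (p ^ j), F.1 ((z + h) / p ^ j) := by
  induction j generalizing F with
  | zero => simp
  | succ j ih =>
    rw [pow_succ, Module.End.mul_apply, ih, pow_succ, sum_range_mul]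
    simp_rw [atk_apply]
    refine Eq.trans (Finset.sum_congr rfl fun h _ => ?_) Finset.sum_comm
    rw [sum_zmod (A := ℂ) p (fun a : ℕ => F.1 ((z + h) / p ^ j / p + a / p))]
    refine Finset.sum_congr rfl fun a _ => ?_
    have := p_ne p
    refine congrArg F.1 ?_
    push_cast
    field_simp
    ring

lemma dil_atk_apply (i j : ℕ) (F : Per) (z : ℂ) : ((dil p ^ i * atk p ^ j) F).1 z =
    ∑ h ∈ Finset.range (p ^ j), F.1 ((p ^ i * z + h) / p ^ j) := by
  rw [Module.End.mul_apply, dil_pow_apply, atk_pow_apply]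

/-- Summing over the residues prime to `p` only. -/
lemma dil_atk_prim_apply (i j : ℕ) (F : Per) (z : ℂ) :
    ((dil p ^ (i + 1) * atk p ^ (j + 1) - dil p ^ i * atk p ^ j) F).1 z =
    ∑ h ∈ Finset.range (p ^ (j + 1)),
      if p ∣ h then 0 else F.1 ((p ^ (i + 1) * z + h) / p ^ (j + 1)) := by
  have h1 := dil_atk_apply p (i + 1) (j + 1) F z
  have h2 := dil_atk_apply p i j F z
  rw [LinearMap.sub_apply, Submodule.coe_sub, Pi.sub_apply, h1, h2, sub_eq_iff_eq_add,
    pow_succ' p j, sum_range_mul, sum_range_mul, ← Finset.sum_add_distrib]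
  refine Finset.sum_congr rfl fun b _ => ?_
  -- Residues are `a + p b`. Those with `a = 0` give `(p^(i+1) z + p b)/p^(j+1) = (p^i z + b)/p^j`,
  -- exactly the terms of the subtracted word.
  obtain ⟨q, hq⟩ := Nat.exists_eq_succ_of_ne_zero hp.out.ne_zero
  have e : ∀ f : ℕ → ℂ, ∑ a ∈ Finset.range p, f a = ∑ a ∈ Finset.range q, f (a + 1) + f 0 := by
    intro f
    rw [← Finset.sum_range_succ', ← Nat.succ_eq_add_one, ← hq]
  rw [e, e, add_assoc]
  congr 1
  · refine Finset.sum_congr rfl fun a ha => ?_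
    rw [if_neg]
    intro hd
    have h3 : p ∣ a + 1 := (Nat.dvd_add_left (dvd_mul_right p b)).1 hd
    have := Nat.le_of_dvd (by omega) h3
    have := Finset.mem_range.1 ha
    omega
  · rw [if_pos (by simp)]
    refine Eq.trans ?_ (zero_add _).symm
    have := p_ne p
    refine congrArg F.1 ?_
    push_cast
    field_simp
    ring

/-- The sum over residues twisted by the quadratic character. -/
lemma dil_twist_atk_apply (i j : ℕ) (F : Per) (z : ℂ) :
    ((dil p ^ i * (twist p * atk p ^ j)) F).1 z =
    ∑ h ∈ Finset.range (p ^ (j + 1)),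
      quad p (h : ZMod p) * F.1 ((p ^ (i + 1) * z + h) / p ^ (j + 1)) := by
  rw [Module.End.mul_apply, dil_pow_apply, Module.End.mul_apply, twist, sum_apply]
  simp_rw [LinearMap.smul_apply, Submodule.coe_smul, Pi.smul_apply, shift_apply, atk_pow_apply]
  rw [pow_succ' p j, sum_range_mul, Finset.sum_comm]
  have := sum_zmod (A := ℂ) p fun a => quad p (a : ZMod p) •
    ∑ b ∈ Finset.range (p ^ j), F.1 ((p ^ i * z + a / p + b) / p ^ j)
  simp only [ZMod.natCast_val, ZMod.cast_id', id_eq] at this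
  simp only [ZMod.natCast_val]
  rw [this]
  refine Finset.sum_congr rfl fun a _ => ?_
  rw [smul_eq_mul, Finset.mul_sum]
  refine Finset.sum_congr rfl fun b _ => ?_
  have := p_ne p
  congr 1
  · simp
  · refine congrArg F.1 ?_
    push_cast
    field_simp
    ring

end Sums

end Per

/-! ### The recurrence of Hecke operators -/

section Recurrence

variable {E : Type*} [Ring E] [Algebra ℂ E] (u v w : E) (p y g : ℂ)

/-- The contribution of the matrices `(p^i h; 0 p^{2n-i})` to the `n`-th Hecke operator. -/
def part (n i : ℕ) : E :=
  if i = 0 then u ^ (2 * n) else if i = 2 * n then v ^ (2 * n) else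
  if Even i then v ^ i * u ^ (2 * n - i) - v ^ (i - 1) * u ^ (2 * n - i - 1)
  else g • (v ^ (i - 1) * (w * u ^ (2 * n - i - 1)))

/-- The model of the Hecke operator `T_{p^{2n}}` built from the operators `u` and `v` of index `p`
and the twist `w`. -/
def hecke (n : ℕ) : E :=
  (p ^ (2 * n))⁻¹ • ∑ i ∈ Finset.range (2 * n + 1), y ^ i • part u v w g n i

/-- Fails for `i = 0`: there `h` is unrestricted, while for `i + 2 = 2` multiples of `p` are
removed. -/
lemma part_add_two (n i : ℕ) (hi : 1 ≤ i) (hin : i ≤ 2 * n) :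
    part u v w g (n + 1) (i + 2) = v ^ 2 * part u v w g n i := by
  unfold part
  rw [if_neg (by omega : ¬ i + 2 = 0), if_neg (by omega : ¬ i = 0)]
  by_cases h2 : i = 2 * n
  · rw [if_pos (by omega), if_pos h2, ← pow_add]
    congr 1
    omega
  rw [if_neg (by omega), if_neg h2, show 2 * (n + 1) - (i + 2) = 2 * n - i by omega,
    show i + 2 - 1 = 2 + (i - 1) by omega, add_comm i 2]
  by_cases he : Even i
  · rw [if_pos (by simpa [Nat.even_add] using he), if_pos he, mul_sub]
    simp only [pow_add, mul_assoc]
  · rw [if_neg (by simpa [Nat.even_add] using he), if_neg he]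
    simp only [pow_add, mul_assoc, mul_smul_comm]

/-- All terms with `i ≥ 3` are `v²` times terms of the previous operator. Of the `i = 2` term, `v²
u^(2n+2)` supplies the remaining `i = 0` term, and only `-v u^(2n+1)` is left over. -/
lemma hecke_add_two (n : ℕ) : hecke u v w p y g (n + 2) =
    (p ^ (2 * (n + 2)))⁻¹ • (u ^ (2 * n + 4) +
      (y * g) • (w * u ^ (2 * n + 2)) - y ^ 2 • (v * u ^ (2 * n + 1))) +
    ((p ^ 2)⁻¹ * y ^ 2) • (v ^ 2 * hecke u v w p y g (n + 1)) := by
  have h0 : part u v w g (n + 2) 0 = u ^ (2 * n + 4) := by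
    rw [part, if_pos rfl]; rfl
  have h1 : part u v w g (n + 2) 1 = g • (w * u ^ (2 * n + 2)) := by
    rw [part, if_neg (by omega), if_neg (by omega), if_neg (by simp)]
    simp only [Nat.sub_self, pow_zero, one_mul]
    rfl
  have h2 : part u v w g (n + 2) 2 = v ^ 2 * u ^ (2 * n + 2) - v * u ^ (2 * n + 1) := by
    rw [part, if_neg (by omega), if_neg (by omega), if_pos (by simp),
      show 2 * (n + 2) - 2 = 2 * n + 2 by omega, show 2 * n + 2 - 1 = 2 * n + 1 by omega,
      show 2 - 1 = 1 from rfl, pow_one]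
  have h3 : part u v w g (n + 1) 0 = u ^ (2 * n + 2) := by
    rw [part, if_pos rfl]; rfl
  have h4 : ∑ i ∈ Finset.range (2 * n + 2), y ^ (i + 1 + 1 + 1) •
        part u v w g (n + 2) (i + 1 + 1 + 1) =
      y ^ 2 • (v ^ 2 * ∑ i ∈ Finset.range (2 * n + 2),
        y ^ (i + 1) • part u v w g (n + 1) (i + 1)) := by
    rw [Finset.mul_sum, Finset.smul_sum]
    refine Finset.sum_congr rfl fun i hi => ?_
    have := Finset.mem_range.1 hi
    rw [part_add_two u v w g (n + 1) (i + 1) (by omega) (by omega), mul_smul_comm, smul_smul]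
    congr 1
    ring
  have h5 : hecke u v w p y g (n + 2) = (p ^ (2 * (n + 2)))⁻¹ •
      (∑ i ∈ Finset.range (2 * n + 2), y ^ (i + 1 + 1 + 1) • part u v w g (n + 2) (i + 1 + 1 + 1) +
      y ^ 2 • part u v w g (n + 2) 2 + y ^ 1 • part u v w g (n + 2) 1 +
      y ^ 0 • part u v w g (n + 2) 0) := by
    rw [hecke, show 2 * (n + 2) + 1 = 2 * n + 2 + 1 + 1 + 1 by ring,
      Finset.sum_range_succ', Finset.sum_range_succ', Finset.sum_range_succ']
  have h6 : hecke u v w p y g (n + 1) = (p ^ (2 * (n + 1)))⁻¹ •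
      (∑ i ∈ Finset.range (2 * n + 2), y ^ (i + 1) • part u v w g (n + 1) (i + 1) +
      y ^ 0 • part u v w g (n + 1) 0) := by
    rw [hecke, show 2 * (n + 1) + 1 = 2 * n + 2 + 1 by ring, Finset.sum_range_succ']
  rw [h5, h6, h4, h0, h1, h2, h3]
  rw [mul_smul_comm, mul_add (v ^ 2), mul_smul_comm, show 2 * (n + 2) = 2 * (n + 1) + 2 by ring, pow_add p _ 2, mul_inv]
  module

lemma hecke_one : hecke u v w p y g 1 =
    (p ^ 2)⁻¹ • (u ^ 2 + (y * g) • w + y ^ 2 • v ^ 2) := by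
  simp [hecke, part, Finset.sum_range_succ, smul_smul]

variable {u v w p}

lemma u_sq_mul_v (huv : u * v = p • 1) : u ^ 2 * v = p • u := by
  rw [sq, mul_assoc, huv, mul_smul_comm, mul_one]

lemma u_sq_mul_v_sq (huv : u * v = p • 1) : u ^ 2 * v ^ 2 = p ^ 2 • 1 := by
  rw [sq v, ← mul_assoc, u_sq_mul_v huv, smul_mul_assoc, huv, smul_smul, sq]

/-- The scalar `u² v² = p²` turns the tail of `hecke_add_two` into the previous operator, and `u² w
= 0` kills the twisted term. -/
lemma u_sq_mul_hecke (hp : p ≠ 0) (huv : u * v = p • 1) (huw : u * w = 0) (n : ℕ) :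
    u ^ 2 * hecke u v w p y g (n + 2) =
    (p ^ (2 * (n + 2)))⁻¹ • (u ^ (2 * n + 6) - (y ^ 2 * p) • u ^ (2 * n + 2)) +
      y ^ 2 • hecke u v w p y g (n + 1) := by
  have e3 : u ^ 2 * w = 0 := by rw [sq, mul_assoc, huw, mul_zero]
  rw [hecke_add_two]
  simp only [mul_add, mul_sub, mul_smul_comm, ← mul_assoc, u_sq_mul_v huv, u_sq_mul_v_sq huv, e3,
    zero_mul, smul_zero, smul_mul_assoc, one_mul, ← pow_add, ← pow_succ']
  rw [show 2 + (2 * n + 4) = 2 * n + 6 by ring, show 2 * n + 1 + 1 = 2 * n + 2 by ring]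
  match_scalars <;> field_simp

lemma w_mul_hecke (hwv : w * v = 0) (hww : w * w = g ^ 2 • (p • 1 - v * u)) (n : ℕ) :
    w * hecke u v w p y g (n + 2) =
    (p ^ (2 * (n + 2)))⁻¹ • (w * u ^ (2 * n + 4) +
      (y * g ^ 3) • (p • u ^ (2 * n + 2) - v * u ^ (2 * n + 3))) := by
  have e2 : w * v ^ 2 = 0 := by rw [sq, ← mul_assoc, hwv, zero_mul]
  rw [hecke_add_two]
  simp only [mul_add, mul_sub, mul_smul_comm, ← mul_assoc, hwv, e2, zero_mul, smul_zero,
    hww, smul_mul_assoc, one_mul, sub_mul, sub_zero, add_zero]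
  rw [mul_assoc v, ← pow_succ', show 2 * n + 2 + 1 = 2 * n + 3 by ring]
  match_scalars <;> ring

/-- The summand `v²` of `hecke 1` gives the tail of `hecke (n + 3)`, and `u²` gives `hecke (n + 1)`.
The product `w²` contributes `y² g⁴ (p u^(2n+2) - v u^(2n+3))` up to scaling: its first part cancels
the defect in `u_sq_mul_hecke`, its second is the correction `-y² v u^(2n+3)` required by
`hecke_add_two`. -/
lemma hecke_one_mul (hp : p ≠ 0) (hg : g ^ 4 = 1) (huv : u * v = p • 1) (huw : u * w = 0)
    (hwv : w * v = 0) (hww : w * w = g ^ 2 • (p • 1 - v * u)) (n : ℕ) :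
    hecke u v w p y g 1 * hecke u v w p y g (n + 2) =
    hecke u v w p y g (n + 3) + algebraMap ℂ E (y ^ 2 / p ^ 2) * hecke u v w p y g (n + 1) := by
  rw [hecke_one, smul_mul_assoc, add_mul, add_mul, u_sq_mul_hecke y g hp huv huw, smul_mul_assoc,
    w_mul_hecke y g hwv hww, smul_mul_assoc, hecke_add_two u v w p y g (n + 1),
    Algebra.algebraMap_eq_smul_one, smul_mul_assoc, one_mul,
    show 2 * (n + 1) + 4 = 2 * n + 6 by ring, show 2 * (n + 1) + 2 = 2 * n + 4 by ring,
    show 2 * (n + 1) + 1 = 2 * n + 3 by ring, show 2 * (n + 1 + 2) = 2 * (n + 2) + 2 by ring,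
    show n + 1 + 1 = n + 2 by ring, pow_add p (2 * (n + 2)) 2]
  match_scalars <;> field_simp
  · linear_combination y ^ 2 * hg
  · linear_combination -(y ^ 2) * hg

/-- Here `u² v² = p²` yields the scalar `y²/p²`, and the scalar part of `w²` yields the extra `p⁻¹
y²/p²`, which no longer cancels. -/
lemma hecke_one_sq (hp : p ≠ 0) (hg : g ^ 4 = 1) (huv : u * v = p • 1) (huw : u * w = 0)
    (hwv : w * v = 0) (hww : w * w = g ^ 2 • (p • 1 - v * u)) :
    hecke u v w p y g 1 * hecke u v w p y g 1 =
    hecke u v w p y g 2 + algebraMap ℂ E (y ^ 2 / p ^ 2 + p⁻¹ * (y ^ 2 / p ^ 2)) := by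
  have e3 : u ^ 2 * w = 0 := by rw [sq, mul_assoc, huw, mul_zero]
  have e4 : w * v ^ 2 = 0 := by rw [sq, ← mul_assoc, hwv, zero_mul]
  rw [hecke_add_two u v w p y g 0, hecke_one]
  simp only [mul_add, add_mul, mul_smul_comm, smul_mul_assoc, u_sq_mul_v_sq huv, e3, e4, hww,
    smul_zero, Algebra.algebraMap_eq_smul_one, mul_zero, zero_add, pow_one, ← pow_add,
    Nat.reduceAdd]
  match_scalars <;> field_simp
  · ring
  · linear_combination y ^ 2 * hg
  · linear_combination -(y ^ 2 * p ^ 4) * hg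

end Recurrence

/-! ### Injectivity of `Δ₀(N) → SL₂(ℤ)` -/

/-- A nonzero form of odd weight forces `Δ₀(N)` to meet the kernel of the projection trivially. -/
lemma eq_one_of_mem_Delta0 {k N : ℕ} (hk : Odd k) {χ : DirichletCharacter ℂ N} {f : ℍ → ℂ}
    (hf : f ∈ M k χ) (hf0 : f ≠ 0) {x : G} (hx : x ∈ Delta0 N) (hm : x.mat = 1) : x = 1 := by
  obtain ⟨γ, _, hI, e⟩ := slash_Delta0 hf hx
  have h11 : γ 1 1 = 1 := by
    have := congrFun (congrFun hI.1 1) 1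
    rw [hm, Matrix.map_apply] at this
    have h' : (1 : ℚ) = ((γ.1 1 1 : ℤ) : ℚ) := by simpa using this
    exact_mod_cast h'.symm
  rw [h11, Int.cast_one, map_one, one_smul] at e
  have h4 : ∀ z, x.phi z ^ 4 = 1 := by
    obtain ⟨t, ht, h⟩ := x.sq
    intro z
    rw [show 4 = 2 * 2 from rfl, pow_mul, h, hm]
    rcases ht with rfl | rfl <;> simp
  have hcop : Nat.gcd k 4 = 1 := (Nat.coprime_pow_right_iff (n := 2) (by norm_num) k 2).2
    (Nat.coprime_two_right.2 hk)
  -- Where `f ≠ 0`, both `φ^k = 1` and `φ⁴ = 1` hold, so `φ = 1` as `k` is odd. Zeros of `f` are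
  -- harmless: a product of holomorphic functions vanishes only if a factor does.
  have hprod : (x.phi - fun _ => 1) * f = 0 := by
    funext z
    by_cases hz : f z = 0
    · simp [hz]
    · have h1 := congrFun e z
      rw [slash_apply, hm, map_one, one_smul] at h1
      have h2 : x.phi z ^ k = 1 := inv_eq_one.1 (mul_left_cancel₀ hz (h1.trans (mul_one _).symm))
      have h3 := pow_gcd_eq_one.2 ⟨h2, h4 z⟩
      rw [hcop, pow_one] at h3
      simp [h3]
  rcases (mul_eq_zero_iff (x.holo.sub mdifferentiable_const) hf.1.1).1 hprod with h | h
  · exact G.ext hm (sub_eq_zero.1 h)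
  · exact absurd h hf0

lemma coe_smul_mat (x : G) (z : ℍ) : ((toReal x.mat • z : ℍ) : ℂ) =
    ((x.mat.1 0 0 : ℚ) * z + (x.mat.1 0 1 : ℚ)) / ((x.mat.1 1 0 : ℚ) * z + (x.mat.1 1 1 : ℚ)) := by
  rw [coe_smul_of_det_pos x.det_pos_real]
  simp [num, denom, toReal]

lemma xi_mat (n : ℕ) (hn : 0 < n) : (xi n hn).mat.1 = !![1, 0; 0, (n : ℚ) ^ 2] := rfl

lemma kro_sq_mul {n : ℕ} (hn : 0 < n) {c d : ℤ} (h : IsCoprime (n : ℤ) d) :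
    kro ((n : ℤ) ^ 2 * c) d = kro c d := by
  have hn' : (0 : ℤ) < (n : ℤ) ^ 2 := by positivity
  have hg : Int.gcd (n : ℤ) (d.natAbs : ℤ) = 1 := by
    rw [Int.gcd, Int.natAbs_natCast]
    exact Int.isCoprime_iff_gcd_eq_one.1 h
  have hc : (n : ℤ) ^ 2 * c < 0 ↔ c < 0 := by
    constructor <;> intro h <;> nlinarith
  unfold kro
  rw [jacobiSym.mul_left, jacobiSym.sq_one' hg, one_mul]
  simp only [hc]

lemma mapGL_val (γ : SL(2, ℤ)) (i j : Fin 2) :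
    (SpecialLinearGroup.mapGL ℚ γ).1 i j = ((γ i j : ℤ) : ℚ) := by
  simp

variable {N : ℕ}

/-- Conjugation by `ξ` is compatible with the lift. -/
lemma xi_conj {n : ℕ} (hn : 0 < n) {γ γ' : CongruenceSubgroup.Gamma0 4}
    (h : (tilde γ').mat * (xi n hn).mat = (xi n hn).mat * (tilde γ).mat) :
    tilde γ' * xi n hn = xi n hn * tilde γ := by
  refine G.ext h (funext fun z => ?_)
  have hn0 : (n : ℚ) ≠ 0 := Nat.cast_ne_zero.2 hn.ne'
  have hm := congrArg Units.val h
  rw [Units.val_mul, Units.val_mul, xi_mat] at hm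
  -- The bottom rows are related by `c' = n² c`, `d' = d`, so `c' (z/n²) + d' = cz + d` and both
  -- square roots have the same argument.
  have e10 : (γ' : SL(2, ℤ)) 1 0 = (n : ℤ) ^ 2 * (γ : SL(2, ℤ)) 1 0 := by
    have := congrFun (congrFun hm 1) 0
    simp only [Matrix.mul_apply, Fin.sum_univ_two, tilde, mapGL_val] at this
    simp at this
    exact_mod_cast this
  have e11 : (γ' : SL(2, ℤ)) 1 1 = (γ : SL(2, ℤ)) 1 1 := by
    have := congrFun (congrFun hm 1) 1
    simp only [Matrix.mul_apply, Fin.sum_univ_two, tilde, mapGL_val] at this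
    simp [mul_comm, hn0] at this
    exact_mod_cast this
  have hcop : IsCoprime (n : ℤ) ((γ : SL(2, ℤ)) 1 1) := by
    have hdet := (γ' : SL(2, ℤ)).det_coe
    rw [Matrix.det_fin_two, e10, e11] at hdet
    exact ⟨-((γ' : SL(2, ℤ)) 0 1 * n * (γ : SL(2, ℤ)) 1 0), (γ' : SL(2, ℤ)) 0 0,
      by linear_combination hdet⟩
  have hz : ((toReal (xi n hn).mat • z : ℍ) : ℂ) = z / (n : ℂ) ^ 2 := by
    rw [coe_smul_mat, xi_mat]
    simp
  rw [G.mul_phi, G.mul_phi]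
  change theta_j γ' _ * (√(n : ℝ) : ℂ) = (√(n : ℝ) : ℂ) * theta_j γ z
  rw [mul_comm]
  congr 1
  unfold theta_j
  rw [e10, e11, kro_sq_mul hn hcop, hz]
  congr 3
  have : (n : ℂ) ≠ 0 := Nat.cast_ne_zero.2 hn.ne'
  push_cast
  field_simp

/-- Injectivity shows that the closure defining `Delta0` adds nothing to the lifts. -/
lemma exists_tilde_of_mem (hinj : ∀ x ∈ Delta0 N, x.mat = 1 → x = 1) {x : G} (hx : x ∈ Delta0 N) :
    ∃ γ : CongruenceSubgroup.Gamma0 4, x = tilde γ := by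
  obtain ⟨γ, hγ, h⟩ := Delta0_mat hx
  have hd : tilde ⟨γ, hγ.1⟩ ∈ Delta0 N := Subgroup.subset_closure ⟨⟨γ, hγ.1⟩, hγ.2, rfl⟩
  refine ⟨⟨γ, hγ.1⟩, ?_⟩
  refine mul_inv_eq_one.1 (hinj _ (mul_mem hx (inv_mem hd)) ?_)
  rw [G.mul_mat, G.inv_mat, h]
  exact mul_inv_cancel _

/-- An element of `Δ₀(N) ξ Δ₀(N)` is determined by its matrix. -/
lemma doubleCoset_ext (hinj : ∀ x ∈ Delta0 N, x.mat = 1 → x = 1) {n : ℕ} {hn : 0 < n} {x y : G}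
    (hx : x ∈ DoubleCoset.doubleCoset (xi n hn) (Delta0 N : Set G) (Delta0 N))
    (hy : y ∈ DoubleCoset.doubleCoset (xi n hn) (Delta0 N : Set G) (Delta0 N))
    (h : x.mat = y.mat) : x = y := by
  obtain ⟨a, ha, b, hb, rfl⟩ := DoubleCoset.mem_doubleCoset.1 hx
  obtain ⟨c, hc, d, hd, rfl⟩ := DoubleCoset.mem_doubleCoset.1 hy
  obtain ⟨γ', h'⟩ := exists_tilde_of_mem hinj (mul_mem (inv_mem hc) ha)
  obtain ⟨γ, hγ⟩ := exists_tilde_of_mem hinj (mul_mem hd (inv_mem hb))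
  have key : tilde γ' * xi n hn = xi n hn * tilde γ := by
    refine xi_conj hn ?_
    rw [← h', ← hγ]
    simp only [G.mul_mat, G.inv_mat] at h ⊢
    calc c.mat⁻¹ * a.mat * (xi n hn).mat = c.mat⁻¹ * (a.mat * (xi n hn).mat * b.mat) * b.mat⁻¹ := by
          group
      _ = _ := by rw [h]; group
  rw [← h', ← hγ] at key
  calc a * xi n hn * b = c * (c⁻¹ * a * xi n hn) * b := by group
    _ = _ := by rw [key]; group

/-! ### Upper triangular representatives -/

lemma exists_mem_Delta0 (hN : 4 ∣ N) {a b c d : ℤ} (hdet : a * d - b * c = 1) (hc : (N : ℤ) ∣ c) :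
    ∃ x ∈ Delta0 N, x.mat.1 = !![(a : ℚ), b; c, d] ∧ ∀ z : ℍ, x.phi z =
      (kro c d : ℂ) * (eps d)⁻¹ * ((c : ℂ) * z + d) ^ (1 / 2 : ℂ) := by
  let γ : SL(2, ℤ) := ⟨!![a, b; c, d], by rw [Matrix.det_fin_two_of, hdet]⟩
  have h4 : γ ∈ CongruenceSubgroup.Gamma0 4 := CongruenceSubgroup.Gamma0_mem.2
    ((ZMod.intCast_zmod_eq_zero_iff_dvd c 4).2 ((Int.natCast_dvd_natCast.2 hN).trans hc))
  have hNm : γ ∈ CongruenceSubgroup.Gamma0 N := CongruenceSubgroup.Gamma0_mem.2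
    ((ZMod.intCast_zmod_eq_zero_iff_dvd c N).2 hc)
  refine ⟨tilde ⟨γ, h4⟩, Subgroup.subset_closure ⟨⟨γ, h4⟩, hNm, rfl⟩, ?_, fun z => rfl⟩
  ext i j
  simp only [tilde, mapGL_val]
  fin_cases i <;> fin_cases j <;> rfl

/-- With `N = 4M`, the symbol equals `(M/m)`, which depends only on `m` modulo `4M`. -/
lemma jacobiSym_eq_one_of_modEq {m : ℕ} (hN : 4 ∣ N) (hm : m % N = 1 % N) : J(N | m) = 1 := by
  obtain ⟨M, rfl⟩ := hN
  have h4 : m % 4 = 1 := by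
    have := congrArg (· % 4) hm
    simpa [Nat.mod_mod_of_dvd _ (dvd_mul_right 4 M)] using this
  have hodd : Odd m := Nat.odd_iff.2 (by omega)
  rw [Nat.cast_mul, jacobiSym.mul_left, Nat.cast_ofNat, jacobiSym.at_four hodd, one_mul,
    jacobiSym.mod_right' M hodd, hm, ← jacobiSym.mod_right' M odd_one, jacobiSym.one_right]

/-! ### The quadratic symbol of the left factor of a representative -/

section Sign

variable {p i j h D : ℕ} {b : ℤ}

/-- Throughout, `hdet` is the determinant of `(Nh + p^i, b; p^j N, D)`, the left factor in
`exists_rep_pos`. -/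
lemma pow_mul_mod_level (hdet : ((N : ℤ) * h + p ^ i) * D - b * (p ^ j * N) = 1) :
    (D * p ^ i) % N = 1 % N := by
  have : (D * p ^ i : ℤ) ≡ 1 [ZMOD N] :=
    (Int.modEq_iff_dvd.2 ⟨b * p ^ j - h * D, by linear_combination hdet⟩).symm
  exact (Int.natCast_modEq_iff (n := N)).1 (by push_cast; exact this)

lemma pow_mul_mod_four (hN : 4 ∣ N)
    (hdet : ((N : ℤ) * h + p ^ i) * D - b * (p ^ j * N) = 1) : (D * p ^ i) % 4 = 1 := by
  have := congrArg (· % 4) (pow_mul_mod_level hdet)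
  simpa [Nat.mod_mod_of_dvd _ hN] using this

lemma pow_mod_four (hp : Odd p) (i : ℕ) : p ^ i % 4 = if Even i then 1 else p % 4 := by
  have h2 : p * p % 4 = 1 := by
    rw [Nat.mul_mod]
    rcases Nat.odd_mod_four_iff.1 (Nat.odd_iff.1 hp) with h | h <;> simp [h]
  induction i using Nat.twoStepInduction with
  | zero => simp
  | one => simp
  | more i ih _ =>
    rw [show p ^ (i + 2) = p ^ i * (p * p) by ring, Nat.mul_mod, h2, mul_one, Nat.mod_mod, ih]
    simp [Nat.even_add]

lemma mod_four_eq (hN : 4 ∣ N) (hp : Odd p)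
    (hdet : ((N : ℤ) * h + p ^ i) * D - b * (p ^ j * N) = 1) :
    D % 4 = if Even i then 1 else p % 4 := by
  have h4 := pow_mul_mod_four hN hdet
  rw [Nat.mul_mod, pow_mod_four hp] at h4
  split_ifs at h4 ⊢
  · omega
  · rcases Nat.odd_mod_four_iff.1 (Nat.odd_iff.1 hp) with h | h <;> rw [h] at h4 ⊢ <;> omega

/-- Reciprocity in the form needed for the automorphy factor of `(p^i h; 0 p^j)`. -/
lemma jacobiSym_pow_mul (hN : 4 ∣ N) (hp : p.Prime) (hp2 : Odd p) (hpN : ¬ p ∣ N)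
    (hij : Even i ↔ Even j)
    (hdet : ((N : ℤ) * h + p ^ i) * D - b * (p ^ j * N) = 1) :
    J(p ^ j * N | D) = if Even i then 1 else J(-h | p) := by
  have hprime : Fact p.Prime := ⟨hp⟩
  -- This is `(N / D p^i) = 1`, from `D p^i ≡ 1` modulo `N`.
  have hN1 : J(N | D) * J(N | p) ^ i = 1 := by
    have h4 := pow_mul_mod_four hN hdet
    have hD : D ≠ 0 := by rintro rfl; simp at h4
    have := jacobiSym_eq_one_of_modEq hN (pow_mul_mod_level hdet)
    rwa [jacobiSym.mul_right' _ hD (pow_ne_zero _ hp.ne_zero), jacobiSym.pow_right] at this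
  have hNp : J(N | p) ^ 2 = 1 := jacobiSym.sq_one (by
    rw [Int.gcd_natCast_natCast]
    exact ((Nat.Prime.coprime_iff_not_dvd hp).2 hpN).symm)
  have hDodd : Odd D := by
    have h4 := pow_mul_mod_four hN hdet
    have : (D * p ^ i) % 2 = 1 := by omega
    exact (Nat.odd_mul.1 (Nat.odd_iff.2 this)).1
  rw [jacobiSym.mul_left, jacobiSym.pow_left]
  split_ifs with hi
  · obtain ⟨m, rfl⟩ := hi
    obtain ⟨q, rfl⟩ := hij.1 ⟨m, rfl⟩
    rw [← two_mul, pow_mul, hNp, one_pow, mul_one] at hN1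
    rw [hN1, mul_one, ← two_mul, pow_mul]
    rcases Nat.eq_zero_or_pos q with rfl | hq
    · simp
    · rw [jacobiSym.sq_one, one_pow]
      rw [← Int.isCoprime_iff_gcd_eq_one]
      obtain ⟨t, rfl⟩ := Nat.exists_eq_add_of_le' hq
      exact ⟨-(b * p ^ (2 * t + 1) * N), N * h + p ^ (m + m), by linear_combination hdet⟩
  · have hj : ¬ Even j := fun h => hi (hij.2 h)
    obtain ⟨m, hm⟩ := Nat.not_even_iff_odd.1 hi
    obtain ⟨q, hq⟩ := Nat.not_even_iff_odd.1 hj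
    have hND : J(N | D) = J(N | p) := by
      rw [hm, pow_succ, pow_mul, hNp, one_pow, one_mul] at hN1
      linear_combination J(N | p) * hN1 - J(N | D) * hNp
    -- As `i` and `j` are odd, hence positive, `hdet` reads `N h D ≡ 1` modulo `p`.
    have hDp : J(D | p) * (J(N | p) * J(h | p)) = 1 := by
      rw [← jacobiSym.mul_left, ← jacobiSym.mul_left, ← jacobiSym.one_left p]
      refine jacobiSym.mod_left' ?_
      refine Int.ModEq.symm (Int.modEq_iff_dvd.2 ⟨b * p ^ (2 * q) * N - p ^ (2 * m) * D, ?_⟩)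
      rw [hm, hq] at hdet
      linear_combination hdet
    -- Reciprocity with `D ≡ p` modulo `4`: the sign is `-1` exactly when `p ≡ 3`, that is `(-1/p)`.
    have hpD : J(p | D) = J(-1 | p) * J(D | p) := by
      have h4 := mod_four_eq hN hp2 hdet
      rw [if_neg hi] at h4
      rw [jacobiSym.at_neg_one hp2, ← jacobiSym.quadratic_reciprocity_if (Nat.odd_iff.1 hp2)
        (Nat.odd_iff.1 hDodd), h4, ZMod.χ₄_nat_mod_four]
      rcases Nat.odd_mod_four_iff.1 (Nat.odd_iff.1 hp2) with h | h
      · rw [if_neg (by omega), h]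
        simp
      · rw [if_pos ⟨h, h⟩, h]
        simp
    have hpD2 : J(p | D) ^ 2 = 1 := by
      refine jacobiSym.sq_one ?_
      rw [← Int.isCoprime_iff_gcd_eq_one]
      rw [hm, hq] at hdet
      exact ⟨-(b * p ^ (2 * q) * N), N * h + p ^ (2 * m + 1), by linear_combination hdet⟩
    have hh : J(h | p) ^ 2 = 1 :=
      Int.isUnit_sq (IsUnit.of_mul_eq_one (J(D | p) * J(N | p)) (by linear_combination hDp))
    rw [hq, pow_succ, pow_mul, hpD2, one_pow, one_mul, hND, hpD, neg_eq_neg_one_mul (h : ℤ),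
      jacobiSym.mul_left (-1)]
    linear_combination J(-1 | p) * J(h | p) * hDp - J(-1 | p) * J(D | p) * J(N | p) * hh

end Sign

/-- The root of unity in the automorphy factor of the representative `(p^i h; 0 p^j)`. -/
def sgn (p i h : ℕ) : ℂ := if Even i then 1 else (J(-h | p) : ℂ) * (eps p)⁻¹

/-- Since `w₁ = r / w₂` and `w₂` is off the branch cut, the principal logarithms add up without a
jump, so no sign appears. -/
lemma cpow_half_mul {w₁ w₂ : ℂ} {r : ℝ} (hr : 0 < r) (h : w₁ * w₂ = r) (h2 : w₂.im ≠ 0) :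
    w₁ ^ (1 / 2 : ℂ) * w₂ ^ (1 / 2 : ℂ) = (√r : ℂ) := by
  have h0 : w₂ ≠ 0 := by rintro rfl; simp at h2
  have harg : w₂.arg ≠ Real.pi := fun hp => h2 (Complex.arg_eq_pi_iff.1 hp).2
  have h1 : w₁ = r * w₂⁻¹ := by rw [← h, mul_inv_cancel_right₀ h0]
  have hr0 : (r : ℂ) ≠ 0 := Complex.ofReal_ne_zero.2 hr.ne'
  rw [h1, Complex.cpow_def_of_ne_zero (mul_ne_zero hr0 (inv_ne_zero h0)),
    Complex.cpow_def_of_ne_zero h0, Complex.log_ofReal_mul hr (inv_ne_zero h0),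
    Complex.log_inv _ harg, ← Complex.exp_add, Real.sqrt_eq_rpow, Complex.ofReal_cpow hr.le,
    Complex.cpow_def_of_ne_zero hr0, Complex.ofReal_log hr.le]
  congr 1
  push_cast
  ring

/-! ### Upper triangular representatives and their automorphy factors -/

section Reps

variable {p l : ℕ} (hp : p.Prime)

lemma exists_rep_zero (hN : 4 ∣ N) (h : ℕ) :
    ∃ x ∈ DoubleCoset.doubleCoset (xi (p ^ l) (pow_pos hp.pos l)) (Delta0 N : Set G) (Delta0 N),
      x.mat.1 = !![1, (h : ℚ); 0, (p : ℚ) ^ (2 * l)] ∧ ∀ z, x.phi z = (√((p ^ l : ℕ) : ℝ) : ℂ) := by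
  obtain ⟨t, ht, hm, hphi⟩ := exists_mem_Delta0 (a := 1) (b := h) (c := 0) (d := 1) hN (by ring)
    (dvd_zero _)
  refine ⟨xi (p ^ l) (pow_pos hp.pos l) * t, DoubleCoset.mem_doubleCoset.2
    ⟨1, one_mem _, t, ht, by rw [one_mul]⟩, ?_, fun z => ?_⟩
  · rw [G.mul_mat, Units.val_mul, hm, xi_mat]
    ext i j
    fin_cases i <;> fin_cases j <;> simp [Matrix.mul_apply, Fin.sum_univ_two, ← pow_mul, mul_comm]
  · rw [G.mul_phi, hphi]
    have : kro 0 1 = 1 := by simp [kro]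
    simp [this, eps, xi]

/-- Positivity of `D` makes `kro` at `D` an ordinary Jacobi symbol. -/
lemma exists_pos_inverse {a m : ℤ} (hm : 0 < m) (h : IsCoprime a m) :
    ∃ (D : ℕ) (b : ℤ), 0 < D ∧ a * D - b * m = 1 := by
  obtain ⟨u, v, huv⟩ := h
  have hpos : 0 < u + (|u| + 1) * m := by
    have := neg_abs_le u
    nlinarith [abs_nonneg u]
  obtain ⟨D, hD⟩ := Int.eq_ofNat_of_zero_le hpos.le
  exact ⟨D, a * (|u| + 1) - v, by omega, by rw [← hD]; linear_combination huv⟩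

lemma exists_rep_pos (hN : 4 ∣ N) [NeZero N] (hp2 : Odd p) (hpN : ¬ p ∣ N) {i j : ℕ} (h : ℕ)
    (hij : i + j = 2 * l) (hh : j = 0 ∨ (i ≠ 0 ∧ ¬ p ∣ h)) :
    ∃ x ∈ DoubleCoset.doubleCoset (xi (p ^ l) (pow_pos hp.pos l)) (Delta0 N : Set G) (Delta0 N),
      x.mat.1 = !![(p : ℚ) ^ i, (h : ℚ); 0, (p : ℚ) ^ j] ∧
      ∀ z, x.phi z = sgn p i h * (√((p ^ l : ℕ) : ℝ) : ℂ) * (√(((p : ℝ) ^ i)⁻¹) : ℂ) := by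
  have hpar : Even i ↔ Even j := by
    have : Even (i + j) := by rw [hij]; exact even_two_mul l
    exact Nat.even_add.1 this
  have hp0 := hp.pos
  have hN0 : 0 < N := Nat.pos_of_ne_zero (NeZero.ne N)
  have hpNc : IsCoprime (p : ℤ) N :=
    Nat.isCoprime_iff_coprime.2 ((Nat.Prime.coprime_iff_not_dvd hp).2 hpN)
  have hcop : IsCoprime ((N : ℤ) * h + p ^ i) (p ^ j * N) := by
    refine IsCoprime.mul_right ?_ ?_
    · rcases hh with rfl | ⟨hi, hh⟩
      · rw [pow_zero]; exact isCoprime_one_right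
      · refine IsCoprime.pow_right ?_
        obtain ⟨t, rfl⟩ := Nat.exists_eq_succ_of_ne_zero hi
        rw [pow_succ', IsCoprime.add_mul_left_left_iff]
        exact (hpNc.mul_right (Nat.isCoprime_iff_coprime.2
          ((Nat.Prime.coprime_iff_not_dvd hp).2 hh))).symm
    · rw [add_comm, IsCoprime.add_mul_left_left_iff]
      exact hpNc.pow_left
  obtain ⟨D, b, hD, hdet⟩ := exists_pos_inverse (by positivity) hcop
  obtain ⟨s, hs, hsm, hsphi⟩ := exists_mem_Delta0 (a := N * h + p ^ i) (b := b) (c := p ^ j * N)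
    (d := D) hN hdet (dvd_mul_left _ _)
  -- This is `ξ⁻¹ s⁻¹ (p^i h; 0 p^j)`. The top left entry of `s` was chosen so that this is integral
  -- with bottom row `(-N, 1)`, whose symbol and `ε` are trivial.
  obtain ⟨t, ht, htm, htphi⟩ := exists_mem_Delta0 (a := D * p ^ i) (b := D * h - b * p ^ j)
    (c := -N) (d := 1) hN (by linear_combination hdet) (dvd_neg.2 dvd_rfl)
  refine ⟨s * xi (p ^ l) (pow_pos hp.pos l) * t, DoubleCoset.mem_doubleCoset.2
    ⟨s, hs, t, ht, rfl⟩, ?_, fun z => ?_⟩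
  · have hq : ((N : ℚ) * h + p ^ i) * D - b * (p ^ j * N) = 1 := by exact_mod_cast hdet
    have hpl : ((p : ℚ) ^ l) ^ 2 = p ^ i * p ^ j := by rw [← pow_mul, ← pow_add, hij, mul_comm]
    rw [G.mul_mat, G.mul_mat, Units.val_mul, Units.val_mul, hsm, htm, xi_mat]
    push_cast
    rw [hpl]
    ext u v
    fin_cases u <;> fin_cases v <;> simp [Matrix.mul_apply, Fin.sum_univ_two]
    · linear_combination (p : ℚ) ^ i * hq
    · linear_combination (h : ℚ) * hq
    · ring
    · linear_combination (p : ℚ) ^ j * hq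
  · rw [G.mul_phi, G.mul_phi, hsphi, htphi, coe_smul_mat, xi_mat, coe_smul_mat, htm]
    have hxi : ∀ w, (xi (p ^ l) (pow_pos hp.pos l)).phi w = (√((p ^ l : ℕ) : ℝ) : ℂ) := fun _ => rfl
    have hk1 : kro (-(N : ℤ)) 1 = 1 := by simp [kro]
    have hk2 : kro ((p : ℤ) ^ j * N) D = if Even i then 1 else J(-h | p) := by
      rw [← jacobiSym_pow_mul hN hp hp2 hpN hpar hdet]
      simp [kro]
    have he : eps D = if Even i then 1 else eps p := by
      have h4 := mod_four_eq hN hp2 hdet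
      unfold eps
      split_ifs at h4 ⊢ <;> first | rfl | (exfalso; omega)
    have hsgn : ((kro ((p : ℤ) ^ j * N) D : ℤ) : ℂ) * (eps D)⁻¹ = sgn p i h := by
      rw [hk2, he, sgn]
      split_ifs <;> simp
    rw [hxi, hsgn, hk1]
    have him : ((((-N : ℤ) : ℂ) * z + (1 : ℤ)) : ℂ).im ≠ 0 := by
      simp [z.im_ne_zero, hN0.ne']
    have hne : (1 - (N : ℂ) * z) ≠ 0 := by
      intro h0
      refine him ?_
      push_cast
      rw [show -(N : ℂ) * z + 1 = 1 - N * z by ring, h0, Complex.zero_im]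
    have hpc : (p : ℂ) ≠ 0 := Nat.cast_ne_zero.2 hp.ne_zero
    have hr : (0 : ℝ) < ((p : ℝ) ^ i)⁻¹ := by positivity
    have hq : ((N : ℂ) * h + p ^ i) * D - b * (p ^ j * N) = 1 := by exact_mod_cast hdet
    have hpl : ((p : ℂ) ^ l) ^ 2 = p ^ i * p ^ j := by rw [← pow_mul, ← pow_add, hij, mul_comm]
    -- The linear factors of `s` and `t` multiply to the constant `p^(-i)`.
    rw [← cpow_half_mul (w₂ := ((-N : ℤ) : ℂ) * z + (1 : ℤ)) hr ?_ him]
    rotate_left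
    · exact (((p ^ j * N : ℤ) : ℂ) * (((D * p ^ i : ℤ) * z + (D * h - b * p ^ j : ℤ)) /
        ((-N : ℤ) * z + (1 : ℤ)) / ((p : ℂ) ^ l) ^ 2) + (D : ℤ))
    · rw [hpl]
      push_cast
      rw [show -(N : ℂ) * z + 1 = 1 - N * z by ring]
      field_simp
      linear_combination hq
    · have he1 : eps 1 = 1 := by simp [eps]
      simp [he1]
      ring

end Reps

/-! ### Enumeration of the cosets -/

section Cosets

variable {N p l : ℕ}

/-- Hermite reduction inside `Γ₀(N)`: the gcd of the first column is a power of `p`, hence prime to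
`N`, so dividing it out keeps the lower entry divisible by `N`. -/
lemma exists_upper_triangular {m : ℕ} (hp : p.Prime) (hpN : ¬ p ∣ N)
    (W : Matrix (Fin 2) (Fin 2) ℤ)
    (hdet : W 0 0 * W 1 1 - W 0 1 * W 1 0 = p ^ m) (hN : (N : ℤ) ∣ W 1 0) :
    ∃ a b c d : ℤ, a * d - b * c = 1 ∧ (N : ℤ) ∣ c ∧ ∃ i j h : ℕ, i + j = m ∧ h < p ^ j ∧
      !![a, b; c, d] * W = !![(p : ℤ) ^ i, (h : ℤ); 0, (p : ℤ) ^ j] := by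
  have hg0 : 0 < Int.gcd (W 0 0) (W 1 0) := by
    refine Int.gcd_pos_iff.2 ?_
    by_contra! h
    rw [h.1, h.2, zero_mul, mul_zero, sub_zero] at hdet
    exact pow_ne_zero m (Nat.cast_ne_zero.2 hp.ne_zero) hdet.symm
  obtain ⟨u, v, huv, hu, hv⟩ := Int.exists_gcd_one hg0
  set g := Int.gcd (W 0 0) (W 1 0) with hg
  obtain ⟨s, t, hst⟩ := Int.isCoprime_iff_gcd_eq_one.2 huv
  have hgd : (g : ℤ) * (u * W 1 1 - v * W 0 1) = p ^ m := by
    rw [← hdet, hu, hv]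
    ring
  obtain ⟨i, hi, hgi⟩ := (Nat.dvd_prime_pow hp).1
    (Int.natCast_dvd_natCast.1 ⟨_, by push_cast; exact hgd.symm⟩ : g ∣ p ^ m)
  obtain ⟨j, rfl⟩ := Nat.exists_eq_add_of_le hi
  have hp0 : (p : ℤ) ≠ 0 := Nat.cast_ne_zero.2 hp.ne_zero
  have hd : u * W 1 1 - v * W 0 1 = p ^ j := by
    rw [hgi, pow_add] at hgd
    push_cast at hgd
    exact mul_left_cancel₀ (pow_ne_zero i hp0) hgd
  have hNv : (N : ℤ) ∣ v := by
    rw [hv] at hN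
    refine IsCoprime.dvd_of_dvd_mul_right ?_ hN
    rw [hgi, Nat.cast_pow]
    exact (Nat.isCoprime_iff_coprime.2 ((Nat.Prime.coprime_iff_not_dvd hp).2 hpN)).symm.pow_right
  have hpj : (0 : ℤ) < p ^ j := by have := hp.pos; positivity
  obtain ⟨h, hh⟩ := Int.eq_ofNat_of_zero_le (Int.emod_nonneg (s * W 0 1 + t * W 1 1) hpj.ne')
  have hlt := Int.emod_lt_of_pos (s * W 0 1 + t * W 1 1) hpj
  have hq := Int.emod_add_mul_ediv (s * W 0 1 + t * W 1 1) (p ^ j)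
  set q := (s * W 0 1 + t * W 1 1) / (p : ℤ) ^ j
  -- The row `(-v, u)` annihilates the first column; subtracting `q` times it from the Bézout row
  -- `(s, t)` reduces the upper right entry modulo `p^j`.
  refine ⟨s + q * v, t - q * u, -v, u, by linear_combination hst, (dvd_neg).2 hNv, i, j, h, rfl,
    ?_, ?_⟩
  · rw [hh] at hlt
    exact_mod_cast hlt
  · have hgi' : (g : ℤ) = p ^ i := by rw [hgi]; push_cast; rfl
    rw [hh] at hq
    ext x y
    fin_cases x <;> fin_cases y <;> simp [Matrix.mul_apply, Fin.sum_univ_two]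
    · rw [hu, hv, hgi']
      linear_combination (p : ℤ) ^ i * hst
    · linear_combination -hq - q * hd
    · rw [hu, hv]
      ring
    · linear_combination hd

/-- Indices `(i, h)` of the representatives `(p^i h; 0 p^{2l-i})`. -/
def repIndex (p l : ℕ) : Finset (Σ _ : ℕ, ℕ) :=
  (Finset.range (2 * l + 1)).sigma fun i =>
    (Finset.range (p ^ (2 * l - i))).filter fun h => i = 0 ∨ i = 2 * l ∨ ¬ p ∣ h

lemma mem_repIndex {x : Σ _ : ℕ, ℕ} : x ∈ repIndex p l ↔
    x.1 ≤ 2 * l ∧ x.2 < p ^ (2 * l - x.1) ∧ (x.1 = 0 ∨ x.1 = 2 * l ∨ ¬ p ∣ x.2) := by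
  simp [repIndex]

/-- The matrix of the representative with index `(i, h)`. -/
def repMat (p l : ℕ) (x : Σ _ : ℕ, ℕ) : Matrix (Fin 2) (Fin 2) ℚ :=
  !![(p : ℚ) ^ x.1, (x.2 : ℚ); 0, (p : ℚ) ^ (2 * l - x.1)]

lemma exists_rep [NeZero N] (hN : 4 ∣ N) (hp : p.Prime) (hp2 : Odd p) (hpN : ¬ p ∣ N)
    {x : Σ _ : ℕ, ℕ} (hx : x ∈ repIndex p l) :
    ∃ r ∈ DoubleCoset.doubleCoset (xi (p ^ l) (pow_pos hp.pos l)) (Delta0 N : Set G) (Delta0 N),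
      r.mat.1 = repMat p l x ∧
      ∀ z, r.phi z = sgn p x.1 x.2 * (√((p ^ l : ℕ) : ℝ) : ℂ) * (√(((p : ℝ) ^ x.1)⁻¹) : ℂ) := by
  obtain ⟨i, h⟩ := x
  obtain ⟨h1, h2, h3⟩ := mem_repIndex.1 hx
  dsimp only at h1 h2 h3 ⊢
  rcases Nat.eq_zero_or_pos i with rfl | hi
  · obtain ⟨r, hr, hm, hphi⟩ := exists_rep_zero (l := l) hp hN h
    refine ⟨r, hr, by rw [hm, repMat, pow_zero, Nat.sub_zero], fun z => ?_⟩
    rw [hphi, sgn, if_pos Even.zero]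
    simp
  · refine exists_rep_pos (i := i) (j := 2 * l - i) hp hN hp2 hpN h (by omega) ?_
    rcases h3 with h3 | h3 | h3
    · omega
    · left; omega
    · exact Or.inr ⟨by omega, h3⟩

lemma upper_triangular_unique (hp : p.Prime) {γ : Matrix (Fin 2) (Fin 2) ℤ} {x y : Σ _ : ℕ, ℕ}
    (hx : x ∈ repIndex p l) (hy : y ∈ repIndex p l)
    (h : repMat p l y = γ.map (Int.cast : ℤ → ℚ) * repMat p l x) : x = y := by
  obtain ⟨i, s⟩ := x
  obtain ⟨i', s'⟩ := y
  obtain ⟨h1, h2, -⟩ := mem_repIndex.1 hx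
  obtain ⟨h1', h2', -⟩ := mem_repIndex.1 hy
  dsimp only at h1 h2 h1' h2'
  have e : ∀ a b, repMat p l ⟨i', s'⟩ a b =
      (γ.map (Int.cast : ℤ → ℚ) * repMat p l ⟨i, s⟩) a b := fun a b => by rw [h]
  have hp0 : (p : ℤ) ≠ 0 := Nat.cast_ne_zero.2 hp.ne_zero
  have e00 : (p : ℤ) ^ i' = γ 0 0 * p ^ i := by
    have := e 0 0
    simp [repMat, Matrix.mul_apply, Fin.sum_univ_two] at this
    exact_mod_cast this
  have e10 : 0 = γ 1 0 * p ^ i := by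
    have := e 1 0
    simp [repMat, Matrix.mul_apply, Fin.sum_univ_two, hp.ne_zero] at this
    rw [this, zero_mul]
  have e01 : (s' : ℤ) = γ 0 0 * s + γ 0 1 * p ^ (2 * l - i) := by
    have := e 0 1
    simp [repMat, Matrix.mul_apply, Fin.sum_univ_two] at this
    exact_mod_cast this
  have e11 : (p : ℤ) ^ (2 * l - i') = γ 1 1 * p ^ (2 * l - i) := by
    have h0 : γ 1 0 = 0 := (mul_eq_zero.1 e10.symm).resolve_right (pow_ne_zero _ hp0)
    have := e 1 1
    simp [repMat, Matrix.mul_apply, Fin.sum_univ_two, h0] at this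
    exact_mod_cast this
  have le1 : i ≤ i' := (Nat.pow_dvd_pow_iff_le_right hp.one_lt).1
    (Int.natCast_dvd_natCast.1 ⟨γ 0 0, by push_cast; rw [e00]; ring⟩)
  have le2 : 2 * l - i ≤ 2 * l - i' := (Nat.pow_dvd_pow_iff_le_right hp.one_lt).1
    (Int.natCast_dvd_natCast.1 ⟨γ 1 1, by push_cast; rw [e11]; ring⟩)
  obtain rfl : i = i' := by omega
  have h00 : γ 0 0 = 1 := mul_right_cancel₀ (pow_ne_zero i hp0) (by rw [← e00, one_mul])
  rw [h00, one_mul] at e01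
  have hmod : s ≡ s' [MOD p ^ (2 * l - i)] := by
    refine (Int.natCast_modEq_iff).1 (Int.modEq_iff_dvd.2 ⟨γ 0 1, ?_⟩)
    push_cast
    rw [e01]
    ring
  obtain rfl : s = s' := Nat.ModEq.eq_of_lt_of_lt hmod h2 h2'
  rfl

lemma exists_repIndex (hN : 4 ∣ N) (hp : p.Prime) (hpN : ¬ p ∣ N) {w : G}
    (hw : w ∈ DoubleCoset.doubleCoset (xi (p ^ l) (pow_pos hp.pos l))
      (Delta0 N : Set G) (Delta0 N)) :
    ∃ x ∈ repIndex p l, ∃ e ∈ Delta0 N, (e * w).mat.1 = repMat p l x := by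
  obtain ⟨d₁, hd₁, d₂, hd₂, rfl⟩ := DoubleCoset.mem_doubleCoset.1 hw
  obtain ⟨γ₁, hγ₁, h₁⟩ := Delta0_mat hd₁
  obtain ⟨γ₂, hγ₂, h₂⟩ := Delta0_mat hd₂
  let Ξ : Matrix (Fin 2) (Fin 2) ℤ := !![1, 0; 0, (p : ℤ) ^ (2 * l)]
  let W : Matrix (Fin 2) (Fin 2) ℤ := γ₁.1 * Ξ * γ₂.1
  have hW : (d₁ * xi (p ^ l) (pow_pos hp.pos l) * d₂).mat.1 = W.map (Int.cast : ℤ → ℚ) := by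
    have hΞ : (xi (p ^ l) (pow_pos hp.pos l)).mat.1 = Ξ.map (Int.cast : ℤ → ℚ) := by
      rw [xi_mat]
      ext i j
      fin_cases i <;> fin_cases j <;> simp [Ξ, ← pow_mul, mul_comm]
    have hg : ∀ γ : SL(2, ℤ), (SpecialLinearGroup.mapGL ℚ γ).1 = γ.1.map (Int.cast : ℤ → ℚ) :=
      fun γ => by
        ext i j
        exact mapGL_val γ i j
    rw [G.mul_mat, G.mul_mat, Units.val_mul, Units.val_mul, hΞ, h₁, h₂, hg, hg]
    exact ((Matrix.map_mul (f := Int.castRingHom ℚ) (L := γ₁.1 * Ξ) (M := γ₂.1)).trans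
      (congrArg (· * _) (Matrix.map_mul (f := Int.castRingHom ℚ)))).symm
  have hWdet : W 0 0 * W 1 1 - W 0 1 * W 1 0 = p ^ (2 * l) := by
    rw [← Matrix.det_fin_two, Matrix.det_mul, Matrix.det_mul, γ₁.2, γ₂.2, Matrix.det_fin_two_of]
    ring
  have hWN : (N : ℤ) ∣ W 1 0 := by
    have a1 := (ZMod.intCast_zmod_eq_zero_iff_dvd _ N).1 (CongruenceSubgroup.Gamma0_mem.1 hγ₁.2)
    have a2 := (ZMod.intCast_zmod_eq_zero_iff_dvd _ N).1 (CongruenceSubgroup.Gamma0_mem.1 hγ₂.2)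
    have : W 1 0 = γ₁ 1 0 * γ₂.1 0 0 + γ₁.1 1 1 * p ^ (2 * l) * γ₂ 1 0 := by
      simp [W, Ξ, Matrix.mul_apply, Fin.sum_univ_two]
    rw [this]
    exact dvd_add (Dvd.dvd.mul_right a1 _) (Dvd.dvd.mul_left a2 _)
  obtain ⟨a, b, c, d, hdet, hc, i, j, h, hij, hh, hU⟩ := exists_upper_triangular hp hpN W hWdet hWN
  obtain ⟨e, he, hem, -⟩ := exists_mem_Delta0 hN hdet hc
  have hj : j = 2 * l - i := by omega
  refine ⟨⟨i, h⟩, mem_repIndex.2 ⟨by dsimp only; omega, by rw [← hj]; exact hh, ?_⟩, e, he, ?_⟩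
  -- If `p ∣ h` with `0 < i < 2l`, then `p` divides the whole matrix, hence also `ξ`, whose upper
  -- left entry is `1`.
  · by_contra! hcon
    obtain ⟨c1, c2, c3⟩ := hcon
    dsimp only at c1 c2 c3
    obtain ⟨i, rfl⟩ := Nat.exists_eq_succ_of_ne_zero c1
    obtain ⟨j, rfl⟩ : ∃ t, j = t + 1 := Nat.exists_eq_succ_of_ne_zero (by omega)
    obtain ⟨t, rfl⟩ := c3
    let B : Matrix (Fin 2) (Fin 2) ℤ := !![(p : ℤ) ^ i, (t : ℤ); 0, (p : ℤ) ^ j]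
    have hB : !![a, b; c, d] * W = (p : ℤ) • B := by
      rw [hU]
      ext x y
      fin_cases x <;> fin_cases y <;> simp [B, pow_succ, mul_comm]
    have hA : !![d, -b; -c, a] * !![a, b; c, d] = 1 := by
      ext x y
      fin_cases x <;> fin_cases y <;> simp [Matrix.mul_apply, Fin.sum_univ_two] <;>
        first | linear_combination hdet | ring
    have hi1 : γ₁⁻¹.1 * γ₁.1 = 1 := congrArg Subtype.val (inv_mul_cancel γ₁)
    have hi2 : γ₂.1 * γ₂⁻¹.1 = 1 := congrArg Subtype.val (mul_inv_cancel γ₂)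
    have hΞ : Ξ = (p : ℤ) • (γ₁⁻¹.1 * (!![d, -b; -c, a] * B) * γ₂⁻¹.1) := by
      calc Ξ = (γ₁⁻¹.1 * γ₁.1) * Ξ * (γ₂.1 * γ₂⁻¹.1) := by rw [hi1, hi2, one_mul, mul_one]
        _ = γ₁⁻¹.1 * ((!![d, -b; -c, a] * !![a, b; c, d]) * W) * γ₂⁻¹.1 := by
          rw [hA, one_mul]
          simp only [W, mul_assoc]
        _ = _ := by rw [mul_assoc _ _ W, hB, Matrix.mul_smul, Matrix.mul_smul, Matrix.smul_mul]
    have h00 := congrFun (congrFun hΞ 0) 0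
    rw [Matrix.smul_apply, smul_eq_mul] at h00
    have hd1 : (p : ℤ) ∣ 1 := ⟨_, h00⟩
    exact hp.one_lt.ne' (Nat.dvd_one.1 (by exact_mod_cast hd1))
  · rw [G.mul_mat, Units.val_mul, hW, hem]
    have := congrArg (fun A : Matrix (Fin 2) (Fin 2) ℤ => A.map (Int.castRingHom ℚ)) hU
    rw [Matrix.map_mul] at this
    convert this using 1
    · congr 1
      ext x y
      fin_cases x <;> fin_cases y <;> rfl
    · rw [hj]
      ext x y
      fin_cases x <;> fin_cases y <;> simp [repMat]

/-- The sum over cosets in terms of upper triangular representatives. -/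
lemma cosetSum_eq [NeZero N] {k : ℕ} {χ : DirichletCharacter ℂ N} {f : ℍ → ℂ} (hf : f ∈ M k χ)
    (hinj : ∀ x ∈ Delta0 N, x.mat = 1 → x = 1) (hN : 4 ∣ N) (hp : p.Prime) (hpN : ¬ p ∣ N)
    (rep : (Σ _ : ℕ, ℕ) → G)
    (hrep : ∀ x ∈ repIndex p l, rep x ∈ DoubleCoset.doubleCoset (xi (p ^ l) (pow_pos hp.pos l))
      (Delta0 N : Set G) (Delta0 N))
    (hmat : ∀ x ∈ repIndex p l, (rep x).mat.1 = repMat p l x) :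
    cosetSum k χ (p ^ l) (pow_pos hp.pos l) f = ∑ x ∈ repIndex p l, term k χ (rep x) f := by
  rw [cosetSum, LinearMap.sum_apply]
  symm
  refine Finset.sum_bij (fun x _ => Quotient.mk (QuotientGroup.rightRel (Delta0 N)) (rep x))
    (fun x hx => (cosets_finite N _ _).mem_toFinset.2 ⟨_, hrep x hx, rfl⟩) ?_ ?_ ?_
  · intro x hx y hy hxy
    obtain ⟨γ, -, h⟩ := Delta0_mat (coset_eq.1 hxy)
    refine upper_triangular_unique hp (γ := γ.1) hx hy ?_
    have h' : (rep y).mat = SpecialLinearGroup.mapGL ℚ γ * (rep x).mat := by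
      rw [← h, G.mul_mat, G.inv_mat, inv_mul_cancel_right]
    rw [← hmat x hx, ← hmat y hy, h', Units.val_mul]
    congr 1
  · intro c hc
    obtain ⟨w, hw, rfl⟩ := (cosets_finite N _ _).mem_toFinset.1 hc
    obtain ⟨x, hx, e, he, h⟩ := exists_repIndex hN hp hpN hw
    obtain ⟨a, ha, b, hb, hab⟩ := DoubleCoset.mem_doubleCoset.1 hw
    -- Agreement of matrices must be lifted to agreement in `G`; this is where injectivity of the
    -- projection enters.
    have hew : rep x = e * w := doubleCoset_ext hinj (hrep x hx)
      (DoubleCoset.mem_doubleCoset.2 ⟨e * a, mul_mem he ha, b, hb, by rw [hab]; group⟩)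
      (Units.ext (by rw [hmat x hx, h]))
    refine ⟨x, hx, coset_eq.2 ?_⟩
    rw [hew, _root_.mul_inv_rev, mul_inv_cancel_left]
    exact inv_mem he
  · intro x hx
    obtain ⟨A, hA⟩ := isInt_of_mem (hrep x hx)
    obtain ⟨e, he, h⟩ := coset_out (N := N) (rep x)
    rw [h, term_left hf hA he]

end Cosets

/-! ### Passage to periodic functions -/

/-- Extension of a function on `ℍ` to `ℂ` by zero. -/
def zeroExt : (ℍ → ℂ) →ₗ[ℂ] (ℂ → ℂ) where
  toFun f z := if h : 0 < z.im then f ⟨z, h⟩ else 0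
  map_add' f g := by
    funext z
    by_cases h : 0 < z.im <;> simp [h]
  map_smul' c f := by
    funext z
    by_cases h : 0 < z.im <;> simp [h]

lemma zeroExt_coe (f : ℍ → ℂ) (z : ℍ) : zeroExt f z = f z := dif_pos z.im_pos

lemma zeroExt_of_not (f : ℍ → ℂ) {z : ℂ} (h : ¬ 0 < z.im) : zeroExt f z = 0 := dif_neg h

section Main

variable {k N p l : ℕ} {χ : DirichletCharacter ℂ N} {f : ℍ → ℂ}

lemma zeroExt_periodic (hN : 4 ∣ N) (hf : f ∈ M k χ) : Function.Periodic (zeroExt f) 1 := by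
  obtain ⟨x, hx, hm, hphi⟩ := exists_mem_Delta0 (a := 1) (b := 1) (c := 0) (d := 1) hN (by ring)
    (dvd_zero _)
  obtain ⟨γ, -, hI, e⟩ := slash_Delta0 hf hx
  have h11 : γ 1 1 = 1 := by
    have := congrFun (congrFun hI.1 1) 1
    rw [hm, Matrix.map_apply] at this
    have h' : (1 : ℚ) = ((γ.1 1 1 : ℤ) : ℚ) := by simpa using this
    exact_mod_cast h'.symm
  rw [h11, Int.cast_one, map_one, one_smul] at e
  have hphi1 : ∀ z, x.phi z = 1 := fun z => by
    rw [hphi]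
    simp [kro, eps]
  intro z
  by_cases hz : 0 < z.im
  · have h1 := congrFun e ⟨z, hz⟩
    rw [slash_apply, hphi1, one_pow, inv_one, mul_one, ← zeroExt_coe f, ← zeroExt_coe f,
      coe_smul_mat, hm] at h1
    simpa using h1
  · rw [zeroExt_of_not f hz, zeroExt_of_not f (by simpa using hz)]

/-- A form as a periodic function on `ℂ`. -/
def toPer (k : ℕ) (χ : DirichletCharacter ℂ N) (hN : 4 ∣ N) : M k χ →ₗ[ℂ] Per where
  toFun f := ⟨zeroExt f.1, zeroExt_periodic hN f.2⟩
  map_add' f g := Subtype.ext (map_add zeroExt f.1 g.1)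
  map_smul' c f := Subtype.ext (map_smul zeroExt c f.1)

lemma toPer_injective (hN : 4 ∣ N) : Function.Injective (toPer k χ hN) := by
  intro f g h
  refine Subtype.ext (funext fun z => ?_)
  have h' : zeroExt f.1 z = zeroExt g.1 z := congrFun (congrArg Subtype.val h) (z : ℂ)
  rwa [zeroExt_coe, zeroExt_coe] at h'

/-- The weight of the representative `(p^i h; 0 p^j)` in the Hecke operator. -/
def weight (p : ℕ) (g : ℂ) (i h : ℕ) [Fact p.Prime] : ℂ :=
  if Even i then 1 else g * Per.quad p (h : ZMod p)

lemma part_apply [hp : Fact p.Prime] (g : ℂ) {i : ℕ} (hi : i ≤ 2 * l) (F : Per) (z : ℂ) :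
    (part (Per.atk p) (Per.dil p) (Per.twist p) g l i F).1 z =
      ∑ h ∈ (Finset.range (p ^ (2 * l - i))).filter fun h => i = 0 ∨ i = 2 * l ∨ ¬ p ∣ h,
        weight p g i h * F.1 ((p ^ i * z + h) / p ^ (2 * l - i)) := by
  unfold part
  by_cases h0 : i = 0
  · subst h0
    rw [if_pos rfl, Per.atk_pow_apply, Finset.filter_true_of_mem (by simp)]
    simp [weight]
  rw [if_neg h0]
  by_cases h2 : i = 2 * l
  · subst h2
    rw [if_pos rfl, Per.dil_pow_apply, Finset.filter_true_of_mem (by simp)]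
    simp [weight]
  rw [if_neg h2]
  obtain ⟨i, rfl⟩ := Nat.exists_eq_succ_of_ne_zero h0
  obtain ⟨j, hj⟩ : ∃ j, 2 * l - (i + 1) = j + 1 := Nat.exists_eq_succ_of_ne_zero (by omega)
  simp only [Nat.succ_eq_add_one, hj, Nat.add_sub_cancel] at *
  rw [Finset.sum_filter]
  by_cases he : Even (i + 1)
  · rw [if_pos he]
    refine (Per.dil_atk_prim_apply p i j F z).trans (Finset.sum_congr rfl fun h _ => ?_)
    simp [h2, weight, he, ite_not]
  · rw [if_neg he, LinearMap.smul_apply, Submodule.coe_smul, Pi.smul_apply,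
      Per.dil_twist_atk_apply, smul_eq_mul, Finset.mul_sum]
    refine Finset.sum_congr rfl fun h _ => ?_
    -- The character vanishes at multiples of `p`, so restricting to `p ∤ h` changes nothing.
    by_cases hd : p ∣ h
    · have : (h : ZMod p) = 0 := (ZMod.natCast_eq_zero_iff h p).2 hd
      simp [h2, hd, this, Per.quad]
    · simp [h2, hd, weight, he, mul_assoc]

lemma hecke_apply [hp : Fact p.Prime] (y g : ℂ) (F : Per) (z : ℂ) :
    (hecke (Per.atk p) (Per.dil p) (Per.twist p) p y g l F).1 z =
      ∑ x ∈ repIndex p l, ((p : ℂ) ^ (2 * l))⁻¹ * y ^ x.1 * weight p g x.1 x.2 *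
        F.1 ((p ^ x.1 * z + x.2) / p ^ (2 * l - x.1)) := by
  rw [hecke, LinearMap.smul_apply, Submodule.coe_smul, Pi.smul_apply, Per.sum_apply, repIndex,
    Finset.sum_sigma, smul_eq_mul, Finset.mul_sum]
  refine Finset.sum_congr rfl fun i hi => ?_
  rw [LinearMap.smul_apply, Submodule.coe_smul, Pi.smul_apply,
    part_apply g (Nat.lt_succ_iff.1 (Finset.mem_range.1 hi)), smul_eq_mul, Finset.mul_sum,
    Finset.mul_sum]
  refine Finset.sum_congr rfl fun h _ => ?_
  ring

lemma quad_intCast [hp : Fact p.Prime] (a : ℤ) : Per.quad p (a : ZMod p) = J(a | p) := by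
  rw [← jacobiSym.legendreSym.to_jacobiSym]
  rfl

/-- The constant of the quadratic twist in the Hecke operator. -/
def twistConst (k p : ℕ) : ℂ := eps p ^ k * J(-1 | p)

lemma eps_sq (hp2 : Odd p) : eps p ^ 2 = J(-1 | p) := by
  rw [jacobiSym.at_neg_one hp2, ZMod.χ₄_nat_mod_four, eps]
  rcases Nat.odd_mod_four_iff.1 (Nat.odd_iff.1 hp2) with h | h
  · rw [if_pos (by omega), h]
    simp
  · rw [if_neg (by omega), h]
    simp

lemma twistConst_sq (hk : Odd k) (hp2 : Odd p) : twistConst k p ^ 2 = J(-1 | p) := by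
  have h2 : (J(-1 | p) : ℂ) ^ 2 = 1 := by
    exact_mod_cast jacobiSym.sq_one (a := -1) (b := p) (by simp)
  obtain ⟨m, rfl⟩ := hk
  rw [twistConst, mul_pow, h2, mul_one, ← pow_mul, mul_comm, pow_mul, eps_sq hp2, pow_succ, pow_mul,
    h2, one_pow, one_mul]

/-- For odd `k` the symbol equals its own inverse `k`-th power, and `(-h/p) = (-1/p)(h/p)`; the
factor `ε_p^k (-1/p)` is `twistConst`. -/
lemma sgn_pow_inv [hp : Fact p.Prime] (hk : Odd k) {i h : ℕ} (hh : Odd i → ¬ p ∣ h) :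
    (sgn p i h ^ k)⁻¹ = weight p (twistConst k p) i h := by
  unfold sgn weight
  split_ifs with hi
  · simp
  · have hJ : (J(-h | p) : ℂ) ^ 2 = 1 := by
      have := jacobiSym.sq_one (a := -h) (b := p) (by
        rw [Int.neg_gcd, Int.gcd_natCast_natCast]
        exact ((Nat.Prime.coprime_iff_not_dvd hp.out).2
          (hh (Nat.not_even_iff_odd.1 hi))).symm)
      exact_mod_cast this
    have hq := quad_intCast (p := p) h
    rw [Int.cast_natCast] at hq
    have hJk : ((J(-h | p) : ℂ) ^ k)⁻¹ = J(-h | p) := by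
      obtain ⟨m, rfl⟩ := hk
      rw [pow_succ, pow_mul, hJ, one_pow, one_mul]
      exact inv_eq_of_mul_eq_one_left (by rw [← sq, hJ])
    rw [mul_pow, mul_inv, hJk, inv_pow, inv_inv, hq, twistConst, mul_assoc, mul_comm,
      neg_eq_neg_one_mul (h : ℤ), jacobiSym.mul_left]
    push_cast
    ring

/-- The first factor cancels against the `√(p^l)` in each automorphy factor, leaving the `p^(-2l)`
of `hecke`. -/
lemma rpow_weight (hp : 0 < p) : ((((p ^ l : ℕ) : ℝ) ^ ((k : ℝ) / 2 - 2) : ℝ) : ℂ) =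
    ((√(p : ℝ) : ℂ) ^ l) ^ k * ((p : ℂ) ^ (2 * l))⁻¹ := by
  have hp0 : (0 : ℝ) < p := Nat.cast_pos.2 hp
  have : (((p ^ l : ℕ) : ℝ) ^ ((k : ℝ) / 2 - 2) : ℝ) = (√(p : ℝ) ^ l) ^ k * ((p : ℝ) ^ (2 * l))⁻¹ := by
    rw [Real.sqrt_eq_rpow, Nat.cast_pow, ← Real.rpow_natCast, ← Real.rpow_natCast,
      ← Real.rpow_natCast, ← Real.rpow_natCast, ← Real.rpow_mul hp0.le, ← Real.rpow_mul hp0.le,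
      ← Real.rpow_mul hp0.le, ← Real.rpow_neg hp0.le, ← Real.rpow_add hp0]
    congr 1
    push_cast
    ring
  rw [this]
  push_cast
  rfl

lemma sqrt_pow_eq (n : ℕ) : √((p : ℝ) ^ n) = √(p : ℝ) ^ n := by
  rw [Real.sqrt_eq_iff_eq_sq (by positivity) (by positivity), ← pow_mul, mul_comm, pow_mul,
    Real.sq_sqrt (Nat.cast_nonneg p)]

/-- The Hecke operator on forms is induced by the model on periodic functions. -/
lemma toPer_heckeSq [NeZero N] [hp : Fact p.Prime] (hN : 4 ∣ N) (hk : Odd k) (hp2 : Odd p)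
    (hpN : ¬ p ∣ N) (hinj : ∀ x ∈ Delta0 N, x.mat = 1 → x = 1) (f : M k χ) :
    toPer k χ hN (heckeSq k χ (p ^ l) (pow_pos hp.out.pos l) f) =
      hecke (Per.atk p) (Per.dil p) (Per.twist p) p (χ (p : ZMod N) * (√(p : ℝ) : ℂ) ^ k)
        (twistConst k p) l (toPer k χ hN f) := by
  have hex := fun x (hx : x ∈ repIndex p l) => exists_rep hN hp.out hp2 hpN hx
  choose! rep hrep hmat hphi using hex
  refine Subtype.ext (funext fun z => ?_)
  rw [hecke_apply]
  have hpc : (0 : ℝ) < p := Nat.cast_pos.2 hp.out.pos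
  by_cases hz : 0 < z.im
  · lift z to ℍ using hz
    have h1 : (toPer k χ hN (heckeSq k χ (p ^ l) (pow_pos hp.out.pos l) f)).1 (z : ℂ) =
        ((((p ^ l : ℕ) : ℝ) ^ ((k : ℝ) / 2 - 2) : ℝ) : ℂ) *
          cosetSum k χ (p ^ l) (pow_pos hp.out.pos l) f.1 z := zeroExt_coe _ z
    rw [h1, cosetSum_eq f.2 hinj hN hp.out hpN rep hrep hmat, Finset.sum_apply, Finset.mul_sum]
    refine Finset.sum_congr rfl fun x hx => ?_
    have hnum : (((rep x).mat 0 0 : ℚ).num : ℤ) = p ^ x.1 := by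
      have : ((rep x).mat 0 0 : ℚ) = ((p ^ x.1 : ℤ) : ℚ) := by
        have := congrFun (congrFun (hmat x hx) 0) 0
        rw [this]
        simp [repMat]
      rw [this, Rat.num_intCast]
    have hF : f.1 (toReal (rep x).mat • z) =
        (toPer k χ hN f).1 ((p ^ x.1 * z + x.2) / p ^ (2 * l - x.1)) := by
      rw [← zeroExt_coe f.1, coe_smul_mat, hmat x hx]
      simp only [repMat]
      change zeroExt f.1 _ = zeroExt f.1 _
      simp
    rw [term, LinearMap.smul_apply, Pi.smul_apply, slash_apply, hphi x hx, hnum, hF, smul_eq_mul,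
      mul_pow, mul_pow, mul_inv, mul_inv, sgn_pow_inv hk, rpow_weight hp.out.pos]
    · have hs : (√(p : ℝ) : ℂ) ≠ 0 := Complex.ofReal_ne_zero.2 (Real.sqrt_pos.2 hpc).ne'
      rw [Nat.cast_pow, Real.sqrt_inv, sqrt_pow_eq, sqrt_pow_eq]
      have hcomm : ((√(p : ℝ) : ℂ) ^ k) ^ x.1 = ((√(p : ℝ) : ℂ) ^ x.1) ^ k := by
        rw [← pow_mul, ← pow_mul, mul_comm]
      push_cast
      rw [map_pow, mul_pow, inv_pow, inv_inv, hcomm]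
      field_simp
    · intro hodd
      rcases (mem_repIndex.1 hx).2.2 with h | h | h
      · rw [h] at hodd; simp at hodd
      · rw [h, Nat.odd_mul] at hodd; exact absurd hodd.1 (by decide)
      · exact h
  · have h1 : (toPer k χ hN (heckeSq k χ (p ^ l) (pow_pos hp.out.pos l) f)).1 z = 0 :=
      zeroExt_of_not _ hz
    rw [h1]
    symm
    refine Finset.sum_eq_zero fun x _ => ?_
    -- Real affine maps with positive slope preserve the complement of `ℍ`, where the extension is
    -- zero.
    have h2 : (toPer k χ hN f).1 ((p ^ x.1 * z + x.2) / p ^ (2 * l - x.1)) = 0 := by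
      refine zeroExt_of_not _ fun h => hz ?_
      have hc : ((p : ℂ) ^ x.1 * z + x.2) / (p : ℂ) ^ (2 * l - x.1) =
          (((p : ℝ) ^ (2 * l - x.1))⁻¹ : ℝ) * ((((p : ℝ) ^ x.1 : ℝ) : ℂ) * z + ((x.2 : ℝ) : ℂ)) := by
        push_cast
        ring
      rw [hc, Complex.im_ofReal_mul, Complex.add_im,
        Complex.im_ofReal_mul, Complex.ofReal_im, add_zero] at h
      have h3 := pos_of_mul_pos_right h (by positivity)
      exact pos_of_mul_pos_right h3 (by positivity)
    rw [h2, mul_zero]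

end Main

end HalfIntegral

end

/-! ### The theorem -/

theorem mainTheorem5 (k N : ℕ) [NeZero N] (hk : Odd k) (hN : 4 ∣ N)
    (χ : DirichletCharacter ℂ N) (p : ℕ) (hp : p.Prime) (hpN : ¬ p ∣ N) (l : ℕ) (hl : 0 < l) :
    HalfIntegral.heckeSq k χ (p ^ l) (pow_pos hp.pos l) =
      HalfIntegral.heckeSq k χ p hp.pos ^ l -
        ∑ r ∈ Finset.Icc 1 (l / 2),
          (χ ((p ^ (2 * r) : ℕ) : ZMod N) *
            ((HalfIntegral.α r l : ℂ) * (p : ℂ) ^ ((r : ℤ) * ((k : ℤ) - 2) - 1) +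
              (HalfIntegral.β r l : ℂ) * (p : ℂ) ^ ((r : ℤ) * ((k : ℤ) - 2)))) •
            HalfIntegral.heckeSq k χ p hp.pos ^ (l - 2 * r) := by
  open HalfIntegral in
  -- On the zero space all operators agree; otherwise a nonzero form provides `hinj`.
  by_cases hM : ∀ f : M k χ, f = 0
  · exact LinearMap.ext fun f => (hM _).trans (hM _).symm
  push Not at hM
  obtain ⟨f₀, hf₀⟩ := hM
  have hinj : ∀ x ∈ Delta0 N, x.mat = 1 → x = 1 := fun x hx hm =>
    eq_one_of_mem_Delta0 hk f₀.2 (fun h => hf₀ (Subtype.ext h)) hx hm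
  have hpf : Fact p.Prime := ⟨hp⟩
  have hp2 : p ≠ 2 := by
    rintro rfl
    exact hpN ((show 2 ∣ 4 by norm_num).trans hN)
  have hodd : Odd p := hp.odd_of_ne_two hp2
  have hpc : (p : ℂ) ≠ 0 := Nat.cast_ne_zero.2 hp.ne_zero
  let T : ℕ → Module.End ℂ (M k χ) := fun n => heckeSq k χ (p ^ n) (pow_pos hp.pos n)
  have hT1 : T 1 = heckeSq k χ p hp.pos := by
    have : ∀ (n : ℕ) (hn : 0 < n), n = p → heckeSq k χ n hn = heckeSq k χ p hp.pos := by
      rintro n hn rfl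
      rfl
    exact this _ _ (pow_one p)
  have hg : twistConst k p ^ 2 = Per.quad p (-1) := by
    rw [twistConst_sq hk hodd, ← quad_intCast]
    simp
  have hg4 : twistConst k p ^ 4 = 1 := by
    have h4 : twistConst k p ^ 4 = (twistConst k p ^ 2) ^ 2 := by ring
    rw [h4, hg]
    exact Per.quad_sq p (neg_ne_zero.2 one_ne_zero)
  have hww := Per.twist_mul_twist p hp2
  rw [← hg] at hww
  have hTP := fun n f => toPer_heckeSq (k := k) (χ := χ) (l := n) hN hk hodd hpN hinj f
  set y : ℂ := χ (p : ZMod N) * (√(p : ℝ) : ℂ) ^ k with hy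
  -- The identity for the model is pulled back along the injective, intertwining map `toPer`.
  have hrec : ∀ n, T 1 * T (n + 2) = T (n + 3) + algebraMap ℂ _ (y ^ 2 / p ^ 2) * T (n + 1) := by
    intro n
    refine LinearMap.ext fun f => toPer_injective hN ?_
    have h := hecke_one_mul (u := Per.atk p) (v := Per.dil p) (w := Per.twist p) y (twistConst k p) hpc hg4 (Per.atk_mul_dil p)
      (Per.atk_mul_twist p hp2) (Per.twist_mul_dil p hp2) hww n
    have h' := congrArg (fun S => S (toPer k χ hN f)) h
    simp only [Module.End.mul_apply, LinearMap.add_apply, Algebra.algebraMap_eq_smul_one,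
      LinearMap.smul_apply, Module.End.one_apply, map_add, map_smul, T, hTP] at h' ⊢
    exact h'
  have hsq : T 1 * T 1 = T 2 + algebraMap ℂ _ (y ^ 2 / p ^ 2 + (p : ℂ)⁻¹ * (y ^ 2 / p ^ 2)) := by
    refine LinearMap.ext fun f => toPer_injective hN ?_
    have h := hecke_one_sq (u := Per.atk p) (v := Per.dil p) (w := Per.twist p) y (twistConst k p) hpc hg4 (Per.atk_mul_dil p)
      (Per.atk_mul_twist p hp2) (Per.twist_mul_dil p hp2) hww
    have h' := congrArg (fun S => S (toPer k χ hN f)) h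
    simp only [Module.End.mul_apply, LinearMap.add_apply, Algebra.algebraMap_eq_smul_one,
      LinearMap.smul_apply, Module.End.one_apply, map_add, map_smul, T, hTP] at h' ⊢
    exact h'
  have main := eq_aeval_heckePoly T (y ^ 2 / p ^ 2) (p : ℂ)⁻¹ hsq hrec (l - 1)
  rw [Nat.sub_add_cancel hl, hT1] at main
  refine main.trans ?_
  rw [heckePoly, map_sub, map_pow, Polynomial.aeval_X, map_sum]
  congr 1
  refine Finset.sum_congr rfl fun r _ => ?_
  rw [map_mul, map_pow, Polynomial.aeval_X, Polynomial.aeval_C, Algebra.algebraMap_eq_smul_one,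
    smul_mul_assoc, one_mul]
  congr 1
  have hs : ((√(p : ℝ) : ℂ) ^ k) ^ 2 = (p : ℂ) ^ k := by
    rw [← pow_mul, mul_comm, pow_mul, ← Complex.ofReal_pow, Real.sq_sqrt (Nat.cast_nonneg p)]
    simp
  have hc : y ^ 2 / p ^ 2 = χ (p : ZMod N) ^ 2 * (p : ℂ) ^ ((k : ℤ) - 2) := by
    rw [hy, mul_pow, hs, zpow_sub₀ hpc, zpow_natCast, mul_div_assoc]
    rfl
  rw [hc, mul_pow, ← pow_mul, Nat.cast_pow, map_pow, zpow_sub_one₀ hpc, mul_comm (r : ℤ),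
    _root_.zpow_mul, zpow_natCast]
  ring
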